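/- Fix $N\ge 0$. Let $\mathcal A=\{1,\dots,N\}\sqcup\{\bar 1,\dots,\bar N\}$ (unbarred and barred letters), let $\mathcal U$ be the free associative $\mathbb Z$-algebra on the variables $u_z$, $z\in\mathcal A$, and identify its monomials with words $w=w_1\cdots w_t$ in $\mathcal A$ (colored words), so that $x$ also stands for $u_x$. Let $\langle\cdot,\cdot\rangle$ be the bilinear form on $\mathcal U$ for which the words are orthonormal, and for a two-sided ideal $I$ put $I^\perp=\{\gamma\in\mathcal U:\langle f,\gamma\rangle=0\ \forall f\in I\}$. A *shuffle order* is a total order $\lessdot$ on $\mathcal A$ with $1\lessdot\cdots\lessdot N$ and $\bar 1\lessdot\cdots\lessdot\bar N$; the *natural order* $<$ is $1<\bar 1<2<\bar 2<\cdots<N<\bar N$, and $z\!\downarrow$ denotes the immediate predecessor of $z$ in the natural order (when it exists). For a shuffle order $\lessdot$ and $k\ge 0$ let $e_k(\mathbf u)=\sum u_{z_1}\cdots u_{z_k}$ over all $z_1,\dots,z_k\in\mathcal A$ such that for each $i<k$ either $z_i\gtrdot z_{i+1}$ or $z_i=z_{i+1}$ is barred, and let $h_k(\mathbf u)=\sum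 u_{z_1}\cdots u_{z_k}$ over those such that for each $i<k$ either $z_i\lessdot z_{i+1}$ or $z_i=z_{i+1}$ is unbarred; $e_0=h_0=1$ and $e_k=0$ for $k<0$. For a partition $\nu$ with conjugate $\nu'$ and $t=\nu_1$, let $$\mathfrak J_\nu(\mathbf u)=\sum_{\pi\in S_t}\operatorname{sgn}(\pi)\,e_{\nu'_1+\pi(1)-1}(\mathbf u)\cdots e_{\nu'_t+\pi(t)-t}(\mathbf u)\in\mathcal U .$$ For a word $w=w_1\cdots w_t$ let $\mathrm{Des}(w)$ be the set of $i\in\{1,\dots,t-1\}$ such that $w_i\gtrdot w_{i+1}$ or $w_i=w_{i+1}$ is barred, and let $Q_{\mathrm{Des}(w)}(\mathbf x)=\sum x_{i_1}\cdots x_{i_t}$ over $1\le i_1\le\cdots\le i_t$ with $i_j<i_{j+1}$ for $j\in\mathrm{Des}(w)$. For $\gamma=\sum_w\gamma_w w\in\mathcal U$ put $F^\lessdot_\gamma(\mathbf x)=\sum_w\gamma_w Q_{\mathrm{Des}(w)}(\mathbf x)\in\mathbb Z[[x_1,x_2,\dots]]$. The noncommutative super Cauchy product is $$\Omega(\mathbf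 x,\mathbf u)=\prod_{j=1}^{\infty}\bigl(c_{z_1}(x_j)\cdots c_{z_{2N}}(x_j)\bigr),$$ where the $x_j$ commute with everything, $z_1\lessdot\cdots\lessdot z_{2N}$ are the letters, $c_z(x)=(1-u_zx)^{-1}$ for $z$ unbarred and $c_z(x)=1+u_zx$ for $z$ barred. Write $m_\nu$ and $s_\nu$ for the monomial symmetric functions and the Schur functions, and $h_\alpha(\mathbf u)=h_{\alpha_1}(\mathbf u)h_{\alpha_2}(\mathbf u)\cdots$. Let $I_{\mathrm{kron}}$ be the two-sided ideal of $\mathcal U$ given by the following relations, where $x,y,z\in\mathcal A$ and the order is the natural one: $yyx=yxy$ for $y$ unbarred, $x<y$; $zyy=yzy$ for $y$ unbarred, $y<z$; $yyz=yzy$ for $y$ barred, $y<z$; $xyy=yxy$ for $y$ barred, $x<y$; $(xz-zx)y=y(xz-zx)$ for $x=y\!\downarrow=z\!\downarrow\downarrow$; and $xz=zx$ for $x<z\!\downarrow\downarrow$. **Theorem.** (a) Take the natural order. The $e_k(\mathbf u)$ commute in $\mathcal U/I_{\mathrm{kron}}$, and for every $\gamma\in(I_{\mathrm{kron}})^\perp$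 the series $F^<_\gamma(\mathbf x)$ is symmetric and $$F^<_\gamma(\mathbf x)=\sum_\nu s_\nu(\mathbf x)\,\langle\mathfrak J_\nu(\mathbf u),\gamma\rangle .$$ (b) Let $\lessdot$ be any shuffle order. The product $\Omega(\mathbf x,\mathbf u)$ converges coefficientwise, and in $\mathcal U$ $$\Omega(\mathbf x,\mathbf u)=\sum_{w}Q_{\mathrm{Des}(w)}(\mathbf x)\,w=\sum_{\alpha}\mathbf x^\alpha h_\alpha(\mathbf u),$$ over all colored words $w$ and all weak compositions $\alpha$. Hence $F^\lessdot_\gamma(\mathbf x)=\langle\Omega(\mathbf x,\mathbf u),\gamma\rangle$ for all $\gamma\in\mathcal U$. (c) Let $\lessdot$ be any shuffle order and $I$ any two-sided ideal of $\mathcal U$. The $e_k(\mathbf u)$ commute with each other in $\mathcal U/I$ if and only if the $h_k(\mathbf u)$ do. In that case $$\Omega(\mathbf x,\mathbf u)=\sum_\nu m_\nu(\mathbf x)h_\nu(\mathbf u)=\sum_\nu s_\nu(\mathbf x)\mathfrak J_\nu(\mathbf u)\quad\text{in }\mathcal U/I,$$ and for every $\gamma\in I^\perp$ the series $F^\lessdot_\gamma(\mathbf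 x)$ is symmetric and $F^\lessdot_\gamma(\mathbf x)=\sum_\nu s_\nu(\mathbf x)\,\langle\mathfrak J_\nu(\mathbf u),\gamma\rangle$. All sums over $\nu$ are over all partitions. -/

import Mathlib

namespace SuperSchur

/-- A family `f` of formal power series in `x_0, x_1, …` (over a possibly noncommutative ring)
has the formal sum `F`: every monomial occurs in only finitely many members of the family, and
its coefficients there add up to its coefficient in `F`. -/
def HasFormalSum {ι R : Type*} [Semiring R] (f : ι → MvPowerSeries ℕ R)
    (F : MvPowerSeries ℕ R) : Prop :=
  ∀ m : ℕ →₀ ℕ, (Function.support fun i => MvPowerSeries.coeff m (f i)).Finite ∧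
    ∑ᶠ i, MvPowerSeries.coeff m (f i) = MvPowerSeries.coeff m F

/-- `F` is invariant under all permutations of the variables. -/
def IsSymmetricSeries (F : MvPowerSeries ℕ ℤ) : Prop :=
  ∀ σ : Equiv.Perm ℕ, MvPowerSeries.renameEquiv ℤ σ F = F

/-! ### Ordinary symmetric and quasisymmetric functions -/

/-- The content of a tableau: the exponent vector of `x^T`. -/
noncomputable def content {ν : YoungDiagram} (T : SemistandardYoungTableau ν) : ℕ →₀ ℕ :=
  ∑ c ∈ ν.cells, Finsupp.single (T c.1 c.2) 1

/-- The Schur function `s_ν(x) = ∑_T x^T`, the sum over semistandard tableaux of shape `ν`. -/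
noncomputable def schur (ν : YoungDiagram) : MvPowerSeries ℕ ℤ :=
  fun m => (Set.ncard {T : SemistandardYoungTableau ν | content T = m} : ℤ)

open scoped Classical in
/-- The monomial symmetric function `m_ν(x)`, the sum of all distinct monomials whose nonzero
exponents are, up to order, the parts of `ν`. -/
noncomputable def monomialSym (ν : YoungDiagram) : MvPowerSeries ℕ ℤ :=
  fun m => if m.support.val.map m = (ν.rowLens : Multiset ℕ) then 1 else 0

/-- The fundamental quasisymmetric function of degree `t` and descent set `D`: the sum of
`x_{i_0} ⋯ x_{i_{t-1}}` over `i_0 ≤ ⋯ ≤ i_{t-1}` with `i_j < i_{j+1}` whenever `j ∈ D`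
(positions are counted from `0`). -/
noncomputable def fundamentalQSym (t : ℕ) (D : Set ℕ) : MvPowerSeries ℕ ℤ :=
  fun m => (Set.ncard {i : Fin t → ℕ | Monotone i ∧
    (∀ (j : ℕ) (hj : j + 1 < t), j ∈ D → i ⟨j, by omega⟩ < i ⟨j + 1, hj⟩) ∧
    ∑ j, Finsupp.single (i j) 1 = m} : ℤ)

/-! ### Colored words and the free algebra -/

/-- The alphabet: `Sum.inl a` is the unbarred letter `a`, `Sum.inr a` the barred letter `a`. -/
def Letter (N : ℕ) : Type := Fin N ⊕ Fin N

instance (N : ℕ) : Fintype (Letter N) := inferInstanceAs (Fintype (Fin N ⊕ Fin N))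

/-- The unbarred letter `a`. -/
def plain {N : ℕ} (a : Fin N) : Letter N := Sum.inl a

/-- The barred letter `a`. -/
def barred {N : ℕ} (a : Fin N) : Letter N := Sum.inr a

/-- The letter is barred. -/
def IsBarred {N : ℕ} (z : Letter N) : Prop := ∃ a, z = barred a

/-- The letter is unbarred. -/
def IsPlain {N : ℕ} (z : Letter N) : Prop := ∃ a, z = plain a

/-- A shuffle order: a total order on the letters in which the unbarred letters and the barred
letters appear in their usual orders. -/
structure ShuffleOrder (N : ℕ) extends LinearOrder (Letter N) where
  plain_lt : ∀ a b : Fin N, a < b → lt (plain a) (plain b)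
  barred_lt : ∀ a b : Fin N, a < b → lt (barred a) (barred b)

/-- The position of a letter in the natural order (counted from `0`). -/
def naturalRank {N : ℕ} : Letter N → ℕ
  | Sum.inl a => 2 * a
  | Sum.inr a => 2 * a + 1

theorem naturalRank_injective {N : ℕ} : Function.Injective (naturalRank (N := N)) := by
  rintro (a | a) (b | b) h <;> simp only [naturalRank] at h
  · exact congrArg Sum.inl (Fin.ext (by omega))
  · omega
  · omega
  · exact congrArg Sum.inr (Fin.ext (by omega))

/-- The natural order `1 < 1̄ < 2 < 2̄ < ⋯ < N < N̄`. -/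
noncomputable def naturalOrder (N : ℕ) : ShuffleOrder N where
  toLinearOrder := LinearOrder.lift' naturalRank naturalRank_injective
  plain_lt a b h := by
    change naturalRank (plain a) < naturalRank (plain b)
    have : (a : ℕ) < b := h
    simp only [naturalRank, plain]; omega
  barred_lt a b h := by
    change naturalRank (barred a) < naturalRank (barred b)
    have : (a : ℕ) < b := h
    simp only [naturalRank, barred]; omega

/-- `y` is obtained from `x` by going down by one in the natural order:
`x = a + 1` and `y = ā`, or `x = ā` and `y = a`. -/
def IsDown {N : ℕ} (x y : Letter N) : Prop :=
  (∃ a b : Fin N, (b : ℕ) = a + 1 ∧ x = plain b ∧ y = barred a) ∨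
    ∃ a : Fin N, x = barred a ∧ y = plain a

/-- The free associative `ℤ`-algebra `𝒰` on the letters; its `ℤ`-basis of monomials is the set
of colored words. -/
abbrev FreeAlg (N : ℕ) : Type := MonoidAlgebra ℤ (FreeMonoid (Letter N))

/-- The monomial of a colored word. -/
noncomputable def word {N : ℕ} (w : List (Letter N)) : FreeAlg N :=
  MonoidAlgebra.of ℤ (FreeMonoid (Letter N)) (FreeMonoid.ofList w)

/-- The symmetric bilinear form on `𝒰` for which the colored words are orthonormal. -/
noncomputable def pairing {N : ℕ} (f g : FreeAlg N) : ℤ :=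
  f.coeff.sum fun w a => a * g.coeff w

/-- The orthogonal complement `I^⊥`. -/
def perp {N : ℕ} (I : Ideal (FreeAlg N)) : Set (FreeAlg N) :=
  {γ | ∀ f ∈ I, pairing f γ = 0}

/-- The generators of the ideal `I_kron`, in terms of the natural order. -/
inductive KronRel (N : ℕ) : FreeAlg N → Prop
  | yyx (x y : Letter N) : IsPlain y → (naturalOrder N).lt x y →
      KronRel N (word [y, y, x] - word [y, x, y])
  | zyy (z y : Letter N) : IsPlain y → (naturalOrder N).lt y z →
      KronRel N (word [z, y, y] - word [y, z, y])
  | yyz (z y : Letter N) : IsBarred y → (naturalOrder N).lt y z →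
      KronRel N (word [y, y, z] - word [y, z, y])
  | xyy (x y : Letter N) : IsBarred y → (naturalOrder N).lt x y →
      KronRel N (word [x, y, y] - word [y, x, y])
  | rotate (x y z : Letter N) : IsDown y x → IsDown z y →
      KronRel N ((word [x, z] - word [z, x]) * word [y]
        - word [y] * (word [x, z] - word [z, x]))
  | far (x z z' z'' : Letter N) : IsDown z z' → IsDown z' z'' → (naturalOrder N).lt x z'' →
      KronRel N (word [x, z] - word [z, x])

/-- The two-sided ideal `I_kron`. -/
noncomputable def kronIdeal (N : ℕ) : Ideal (FreeAlg N) :=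
  (TwoSidedIdeal.span {f | KronRel N f}).asIdeal

instance (N : ℕ) : (kronIdeal N).IsTwoSided :=
  inferInstanceAs (TwoSidedIdeal.span {f | KronRel N f}).asIdeal.IsTwoSided

/-! ### Noncommutative super symmetric functions -/

section

variable {N : ℕ} (o : ShuffleOrder N)

open scoped Classical in
/-- `e_k(u)`: the sum of the words `z_1 ⋯ z_k` in which each `z_i` is greater than `z_{i+1}`, or
the two are equal barred letters. -/
noncomputable def elem (k : ℕ) : FreeAlg N :=
  ∑ z : Fin k → Letter N,
    if (List.ofFn z).IsChain (fun y x => o.lt x y ∨ (y = x ∧ IsBarred y))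
    then word (List.ofFn z) else 0

/-- `e_k(u)` for an integer `k`; it vanishes for `k < 0`. -/
noncomputable def elemInt (k : ℤ) : FreeAlg N := if k < 0 then 0 else elem o k.toNat

open scoped Classical in
/-- `h_k(u)`: the sum of the words `z_1 ⋯ z_k` in which each `z_i` is less than `z_{i+1}`, or
the two are equal unbarred letters. -/
noncomputable def hom (k : ℕ) : FreeAlg N :=
  ∑ z : Fin k → Letter N,
    if (List.ofFn z).IsChain (fun y x => o.lt y x ∨ (y = x ∧ IsPlain y))
    then word (List.ofFn z) else 0

/-- `h_ν(u) = h_{ν_1}(u) h_{ν_2}(u) ⋯` for a partition `ν`. -/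
noncomputable def homPartition (ν : YoungDiagram) : FreeAlg N := (ν.rowLens.map (hom o)).prod

/-- All elements of the support of `m` are smaller than `bound m`. -/
def bound (m : ℕ →₀ ℕ) : ℕ := m.support.sup id + 1

/-- `h_α(u) = h_{α_0}(u) h_{α_1}(u) ⋯` for a weak composition `α`; the factors beyond the support
of `α` are `h_0(u) = 1` and are omitted. -/
noncomputable def homComposition (α : ℕ →₀ ℕ) : FreeAlg N :=
  ((List.range (bound α)).map fun j => hom o (α j)).prod

/-- The noncommutative super Schur function
`J_ν(u) = ∑_π sgn(π) e_{ν'_1+π(1)-1}(u) ⋯ e_{ν'_t+π(t)-t}(u)`, where `t = ν_1`. -/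
noncomputable def superSchur (ν : YoungDiagram) : FreeAlg N :=
  ∑ π : Equiv.Perm (Fin (ν.rowLen 0)), ((Equiv.Perm.sign π : ℤˣ) : ℤ) •
    (List.ofFn fun i : Fin (ν.rowLen 0) =>
      elemInt o ((ν.colLen i : ℤ) + ((π i : ℕ) : ℤ) - ((i : ℕ) : ℤ))).prod

/-- The `e_k(u)` commute in `𝒰/I`. -/
def ElemCommute (I : Ideal (FreeAlg N)) [I.IsTwoSided] : Prop :=
  ∀ k l : ℕ, Commute (Ideal.Quotient.mk I (elem o k)) (Ideal.Quotient.mk I (elem o l))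

/-- The `h_k(u)` commute in `𝒰/I`. -/
def HomCommute (I : Ideal (FreeAlg N)) [I.IsTwoSided] : Prop :=
  ∀ k l : ℕ, Commute (Ideal.Quotient.mk I (hom o k)) (Ideal.Quotient.mk I (hom o l))

/-- The descent set of a colored word (positions are counted from `0`). -/
def descents (w : List (Letter N)) : Set ℕ :=
  {j | ∃ h : j + 1 < w.length, o.lt w[j + 1] w[j] ∨ (w[j] = w[j + 1] ∧ IsBarred w[j])}

/-- `Q_{Des(w)}(x)`. -/
noncomputable def wordQSym (w : List (Letter N)) : MvPowerSeries ℕ ℤ :=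
  fundamentalQSym w.length (descents o w)

/-- `F_γ(x) = ∑_w γ_w Q_{Des(w)}(x)`. -/
noncomputable def F (γ : FreeAlg N) : MvPowerSeries ℕ ℤ :=
  γ.coeff.sum fun w a => a • wordQSym o w.toList

open scoped Classical in
/-- The factor `c_z(x_j)` of the Cauchy product: `(1 - u_z x_j)⁻¹` for an unbarred letter `z`, and
`1 + u_z x_j` for a barred letter `z`. The variables `x_j` commute with everything. -/
noncomputable def cauchyFactor (z : Letter N) (j : ℕ) : MvPowerSeries ℕ (FreeAlg N) :=
  if IsBarred z then 1 + MvPowerSeries.C (word [z]) * MvPowerSeries.X j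
  else MvPowerSeries.invOfUnit (1 - MvPowerSeries.C (word [z]) * MvPowerSeries.X j) 1

/-- The product of the first `n` blocks `c_{z_1}(x_j) ⋯ c_{z_{2N}}(x_j)` of the Cauchy product,
where `z_1, …, z_{2N}` are the letters in increasing order. -/
noncomputable def cauchyPartial (n : ℕ) : MvPowerSeries ℕ (FreeAlg N) :=
  letI := o.toLinearOrder
  ((List.range n).map fun j =>
    (((Finset.univ : Finset (Letter N)).sort (· ≤ ·)).map fun z => cauchyFactor z j).prod).prod

/-- The noncommutative super Cauchy product `Ω(x, u)`, the infinite product of all blocks: the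
blocks beyond the variables of a monomial do not contribute to its coefficient. -/
noncomputable def cauchy : MvPowerSeries ℕ (FreeAlg N) :=
  fun m => MvPowerSeries.coeff m (cauchyPartial o (bound m))

end

/-- The series `f(x) a` with coefficients in `A`, for an integral series `f` and `a ∈ A`. -/
noncomputable def seriesMul {A : Type*} [Ring A] (f : MvPowerSeries ℕ ℤ) (a : A) :
    MvPowerSeries ℕ A :=
  fun m => MvPowerSeries.coeff m f • a

end SuperSchur

/-! All series here are built from chains of letters. Multiplying the factors `(1 - u_z x)⁻¹` or `1
+ u_z x` along a strictly ordered list of letters gives the generating function of its chains,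
repetition being allowed exactly at the inverted factors (`prod_factors_eq_oneVar`). So the block of
`x_j` in the Cauchy product is `∑ h_k(u) x_j^k`, and the coefficient of `x^m` in `Ω` is `h_m(u)`. A
word `w` occurs in `h_m(u)` at most once: the parts of `m` prescribe where it is cut, and the pieces
are chains iff every descent of `w` is at a cut, which is the condition for `x^m` to occur in
`Q_{Des(w)}` (`wordCoeff_homComposition`). Hence (b), and the coefficient of `x^m` in `F_γ` is
`⟨h_m(u), γ⟩`.

For (c), `E(-x) H(x) = 1` makes each of the two families polynomial in the other, so commutation
passes between them. If it holds, the `e_k` and `h_k` lie in a commutative subring of `𝒰/I`, and the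
statement becomes one about two sequences in a commutative ring: `∏ h_{m_j} = ∑_ν K_{ν,m}
det(e_{ν'_i + j - i})`. It follows by iterating the Pieri rule (`mul_schurDet`), proved directly on
determinants, in parallel with removing the largest entries of a semistandard tableau
(`kostka_eq_sum`). Symmetry holds because `h_m` no longer depends on the order of the parts. The
pairing with `γ ∈ I^⊥` factors through `𝒰/I`.

For (a), it remains to see that the `e_k` commute modulo `I_kron`. Let `A_n(s)` be the product of
the factors at `s` of the `n` smallest letters, in decreasing order, and `v` the next letter. The
relations give `A_n(s) v = (v + g s) A_n(s)` with `g` independent of `s`, where `v g = 0` for `v`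
unbarred and `g v = 0` for `v` barred. With this, `A_{n+1}(s) A_{n+1}(t)` can be written
symmetrically in `s` and `t`, given that `A_n(s)` and `A_n(t)` commute. Induction on `n` gives `E(s)
E(t) = E(t) E(s)`. -/

namespace SuperSchur

/-! ### Coefficients of words -/

section WordSums

variable {N : ℕ}

/-- The coefficient of a colored word, as an additive map. -/
noncomputable def wordCoeff (w : List (Letter N)) : FreeAlg N →+ ℤ where
  toFun f := f.coeff (FreeMonoid.ofList w)
  map_zero' := rfl
  map_add' _ _ := rfl

theorem wordCoeff_apply (w : List (Letter N)) (f : FreeAlg N) :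
    wordCoeff w f = f.coeff (FreeMonoid.ofList w) := rfl

theorem ext_wordCoeff {f g : FreeAlg N} (h : ∀ w, wordCoeff w f = wordCoeff w g) : f = g := by
  apply MonoidAlgebra.coeff_injective
  ext w
  exact h w.toList

open scoped Classical in
theorem wordCoeff_word (w v : List (Letter N)) :
    wordCoeff w (word v) = if w = v then 1 else 0 := by
  rw [wordCoeff_apply, word, MonoidAlgebra.of_apply, MonoidAlgebra.coeff_single,
    Finsupp.single_apply]
  simp [eq_comm]

theorem word_nil : word ([] : List (Letter N)) = 1 := rfl

theorem word_append (v w : List (Letter N)) : word (v ++ w) = word v * word w := by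
  rw [word, FreeMonoid.ofList_append, map_mul]; rfl

/-- In a free monoid, the factorizations of a word into two are its cuts at one of `length + 1`
positions. -/
theorem wordCoeff_mul (w : List (Letter N)) (f g : FreeAlg N) :
    wordCoeff w (f * g) =
      ∑ i ∈ Finset.range (w.length + 1), wordCoeff (w.take i) f * wordCoeff (w.drop i) g := by
  classical
  have hinj : Set.InjOn (fun i => (FreeMonoid.ofList (w.take i), FreeMonoid.ofList (w.drop i)))
      (Finset.range (w.length + 1) : Set ℕ) := by
    intro i hi j hj h
    simp only [Finset.coe_range, Set.mem_Iio] at hi hj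
    have := congrArg (fun p => p.1.toList.length) h
    simp only [FreeMonoid.toList_ofList, List.length_take] at this
    omega
  rw [wordCoeff_apply, MonoidAlgebra.coeff_mul_antidiag f g _
    ((Finset.range (w.length + 1)).image
      fun i => (FreeMonoid.ofList (w.take i), FreeMonoid.ofList (w.drop i))), Finset.sum_image hinj]
  · rfl
  · rintro ⟨u, v⟩
    simp only [Finset.mem_image, Finset.mem_range, Prod.mk.injEq]
    constructor
    · rintro ⟨i, -, rfl, rfl⟩
      rw [← FreeMonoid.ofList_append, List.take_append_drop]
    · intro h
      have h' : u.toList ++ v.toList = w := by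
        rw [← FreeMonoid.toList_mul, h, FreeMonoid.toList_ofList]
      refine ⟨u.toList.length, ?_, ?_, ?_⟩
      · rw [← h', List.length_append]; omega
      · rw [← h', List.take_left]; rfl
      · rw [← h', List.drop_left]; rfl

theorem wordCoeff_nil_letter_mul (z : Letter N) (f : FreeAlg N) :
    wordCoeff [] (word [z] * f) = 0 := by
  rw [wordCoeff_mul]
  simp [wordCoeff_word]

open scoped Classical in
theorem wordCoeff_cons_letter_mul (z a : Letter N) (w : List (Letter N)) (f : FreeAlg N) :
    wordCoeff (a :: w) (word [z] * f) = if a = z then wordCoeff w f else 0 := by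
  rw [wordCoeff_mul, Finset.sum_eq_single 1]
  · simp [wordCoeff_word]
  · intro i hi h1
    rw [wordCoeff_word, if_neg, zero_mul]
    intro h
    have := congrArg List.length h
    simp only [List.length_take, List.length_cons, List.length_nil, Finset.mem_range] at this hi
    omega
  · simp

open scoped Classical in
/-- The sum of all words of length `k` with the property `P`. -/
noncomputable def wordSum (P : List (Letter N) → Prop) (k : ℕ) : FreeAlg N :=
  ∑ z : Fin k → Letter N, if P (List.ofFn z) then word (List.ofFn z) else 0

open scoped Classical in
theorem wordCoeff_wordSum (P : List (Letter N) → Prop) (k : ℕ) (w : List (Letter N)) :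
    wordCoeff w (wordSum P k) = if w.length = k ∧ P w then 1 else 0 := by
  rw [wordSum, map_sum]
  have h : ∀ z : Fin k → Letter N, wordCoeff w (if P (List.ofFn z) then word (List.ofFn z) else 0)
      = if w = List.ofFn z ∧ P w then 1 else 0 := by
    intro z
    by_cases hw : w = List.ofFn z
    · subst hw
      by_cases hP : P (List.ofFn z)
      · rw [if_pos hP, if_pos ⟨rfl, hP⟩, wordCoeff_word, if_pos rfl]
      · rw [if_neg hP, if_neg fun h => hP h.2, map_zero]
    · rw [if_neg (fun h : _ ∧ _ => hw h.1)]
      split_ifs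
      · rw [wordCoeff_word, if_neg hw]
      · rw [map_zero]
  rw [Finset.sum_congr rfl fun z _ => h z]
  split_ifs with hP
  · obtain ⟨rfl, hP⟩ := hP
    rw [Finset.sum_eq_single w.get]
    · rw [if_pos ⟨(List.ofFn_get w).symm, hP⟩]
    · intro z _ hz
      rw [if_neg]
      rintro ⟨h, -⟩
      apply hz
      apply List.ofFn_injective
      rw [← h, List.ofFn_get]
    · simp
  · apply Finset.sum_eq_zero
    intro z _
    rw [if_neg]
    rintro ⟨rfl, h⟩
    exact hP ⟨List.length_ofFn, h⟩

theorem wordSum_congr {P Q : List (Letter N) → Prop} (h : ∀ w, P w ↔ Q w) (k : ℕ) :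
    wordSum P k = wordSum Q k := by
  rw [show P = Q from funext fun w => propext (h w)]

theorem wordSum_zero {P : List (Letter N) → Prop} (h : P []) : wordSum P 0 = 1 := by
  classical
  rw [wordSum]
  simp [h, word_nil]

end WordSums

/-! ### Generating functions of chains of letters -/

section Chains

variable {N : ℕ}

/-- The relation of consecutive letters in a chain: related by `r`, or equal and repeatable. -/
def ChainRel (r : Letter N → Letter N → Prop) (p : Letter N → Prop) (a b : Letter N) : Prop :=
  r a b ∨ (a = b ∧ p a)

theorem ChainRel.trans {r : Letter N → Letter N → Prop} [IsTrans (Letter N) r]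
    {p : Letter N → Prop} {a b c : Letter N} (h : ChainRel r p a b) (h' : ChainRel r p b c) :
    ChainRel r p a c := by
  rcases h with h | ⟨rfl, h⟩
  · rcases h' with h' | ⟨rfl, -⟩
    · exact Or.inl (_root_.trans h h')
    · exact Or.inl h
  · exact h'

instance (r : Letter N → Letter N → Prop) [IsTrans (Letter N) r] (p : Letter N → Prop) :
    IsTrans (Letter N) (ChainRel r p) := ⟨fun _ _ _ => ChainRel.trans⟩

/-- The sum of the chains of length `k` with letters in the list `L`. -/
noncomputable def chainSum (r : Letter N → Letter N → Prop) (p : Letter N → Prop)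
    (L : List (Letter N)) (k : ℕ) : FreeAlg N :=
  wordSum (fun w => w.Pairwise (ChainRel r p) ∧ ∀ a ∈ w, a ∈ L) k

theorem chainSum_zero (r : Letter N → Letter N → Prop) (p : Letter N → Prop)
    (L : List (Letter N)) : chainSum r p L 0 = 1 :=
  wordSum_zero (by simp)

theorem chainSum_nil_succ (r : Letter N → Letter N → Prop) (p : Letter N → Prop) (k : ℕ) :
    chainSum r p [] (k + 1) = 0 := by
  apply ext_wordCoeff
  intro w
  rw [chainSum, wordCoeff_wordSum, map_zero, if_neg]
  rintro ⟨h, -, h'⟩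
  cases w with
  | nil => simp at h
  | cons a w => simpa using h' a

open scoped Classical in
-- As `z` comes before all of `L`, a chain either avoids `z` or starts with it; after that first
-- `z`, the letter may return only if it is repeatable.
theorem chainSum_cons_succ {r : Letter N → Letter N → Prop} [IsStrictOrder (Letter N) r]
    (p : Letter N → Prop) {z : Letter N} {L : List (Letter N)} (hL : (z :: L).Pairwise r) (k : ℕ) :
    chainSum r p (z :: L) (k + 1) =
      chainSum r p L (k + 1) + word [z] * chainSum r p (if p z then z :: L else L) k := by
  obtain ⟨hz, -⟩ := List.pairwise_cons.1 hL
  have hzL : z ∉ L := fun h => irrefl z (hz z h)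
  apply ext_wordCoeff
  intro w
  rw [map_add]
  cases w with
  | nil => rw [wordCoeff_nil_letter_mul]; simp [chainSum, wordCoeff_wordSum]
  | cons a w =>
    rw [wordCoeff_cons_letter_mul]
    simp only [chainSum, wordCoeff_wordSum, List.length_cons, add_left_inj, List.pairwise_cons,
      List.mem_cons, forall_eq_or_imp]
    by_cases haz : a = z
    · subst haz
      simp only [hzL, false_and, and_false, if_false, zero_add, if_true]
      congr 1
      apply propext
      constructor
      · rintro ⟨hk, ⟨h1, h2⟩, -, h3⟩
        refine ⟨hk, h2, fun b hb => ?_⟩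
        rcases h1 b hb with h | ⟨rfl, h⟩
        · have : b ∈ L := (h3 b hb).resolve_left fun e => irrefl a (e ▸ h)
          split_ifs <;> simp [this]
        · simp [h]
      · rintro ⟨hk, h2, h3⟩
        refine ⟨hk, ⟨fun b hb => ?_, h2⟩, Or.inl trivial, fun b hb => ?_⟩
        · specialize h3 b hb
          split_ifs at h3 with hp
          · rcases List.mem_cons.1 h3 with rfl | h
            · exact Or.inr ⟨rfl, hp⟩
            · exact Or.inl (hz b h)
          · exact Or.inl (hz b h3)
        · specialize h3 b hb
          split_ifs at h3 with hp
          · exact List.mem_cons.1 h3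
          · exact Or.inr h3
    · simp only [haz, false_or, if_false, add_zero]
      congr 1
      apply propext
      constructor
      · rintro ⟨hk, ⟨h1, h2⟩, h3, h4⟩
        refine ⟨hk, ⟨h1, h2⟩, h3, fun b hb => (h4 b hb).resolve_left ?_⟩
        rintro rfl
        rcases h1 b hb with h | ⟨h, -⟩
        · exact irrefl _ (_root_.trans h (hz a h3))
        · exact haz h
      · rintro ⟨hk, ⟨h1, h2⟩, h3, h4⟩
        exact ⟨hk, ⟨h1, h2⟩, h3, fun b hb => Or.inr (h4 b hb)⟩

end Chains

/-! ### Power series in a single one of the variables -/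

section OneVariable

variable {σ A : Type*} [Ring A]

open scoped Classical in
/-- The power series `∑ k, f k * X j ^ k`. -/
noncomputable def oneVar (j : σ) (f : ℕ → A) : MvPowerSeries σ A :=
  fun m => if m = Finsupp.single j (m j) then f (m j) else 0

open scoped Classical in
theorem coeff_oneVar (j : σ) (f : ℕ → A) (m : σ →₀ ℕ) :
    MvPowerSeries.coeff m (oneVar j f) = if m = Finsupp.single j (m j) then f (m j) else 0 := rfl

theorem coeff_letter_mul_oneVar (j : σ) (a : A) (f : ℕ → A) :
    MvPowerSeries.C a * MvPowerSeries.X j * oneVar j f =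
      oneVar j (fun k => if k = 0 then 0 else a * f (k - 1)) := by
  classical
  ext m
  rw [← MvPowerSeries.monomial_zero_eq_C_apply, MvPowerSeries.X_def,
    MvPowerSeries.monomial_mul_monomial, zero_add, mul_one, MvPowerSeries.coeff_monomial_mul,
    coeff_oneVar, coeff_oneVar]
  simp only [Finsupp.single_le_iff]
  by_cases h : m j = 0
  · simp [h]
  · have h1 : 1 ≤ m j := by omega
    rw [if_pos h1]
    have : m - Finsupp.single j 1 = Finsupp.single j ((m - Finsupp.single j 1 : σ →₀ ℕ) j) ↔
        m = Finsupp.single j (m j) := by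
      simp only [Finsupp.ext_iff, Finsupp.tsub_apply]
      refine forall_congr' fun i => ?_
      by_cases hi : j = i
      · subst hi; simp
      · simp [Finsupp.single_eq_of_ne' hi]
    simp only [this, h, if_false]
    split_ifs <;> simp

/-- `Z` is the factor `(1 - a)⁻¹` (if `b`) or `1 + a` (otherwise). -/
def IsFactor (b : Prop) (a Z : A) : Prop :=
  (b ∧ Z * (1 - a) = 1 ∧ (1 - a) * Z = 1) ∨ (¬b ∧ Z = 1 + a)

theorem oneVar_add (j : σ) (f g : ℕ → A) : oneVar j (f + g) = oneVar j f + oneVar j g := by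
  ext m
  rw [map_add, coeff_oneVar, coeff_oneVar, coeff_oneVar]
  split_ifs <;> simp

/-- The product of the factors of the letters of a strictly ordered list is the generating
function of the chains. -/
theorem prod_factors_eq_oneVar {N : ℕ} {r : Letter N → Letter N → Prop}
    [IsStrictOrder (Letter N) r] (p : Letter N → Prop) (φ : FreeAlg N →+* A) (ε : ℤ) (j : σ)
    (Z : Letter N → MvPowerSeries σ A)
    (hZ : ∀ z, IsFactor (p z) (MvPowerSeries.C (ε • φ (word [z])) * MvPowerSeries.X j) (Z z))
    {L : List (Letter N)} (hL : L.Pairwise r) :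
    (L.map Z).prod = oneVar j fun k => ε ^ k • φ (chainSum r p L k) := by
  classical
  induction L with
  | nil =>
    ext m
    rw [List.map_nil, List.prod_nil, coeff_oneVar, MvPowerSeries.coeff_one]
    by_cases h : m = 0
    · simp [h, chainSum_zero]
    · rw [if_neg h]
      split_ifs with h'
      · have : m j ≠ 0 := fun h0 => h (by rw [h', h0, Finsupp.single_zero])
        obtain ⟨k, hk⟩ := Nat.exists_eq_succ_of_ne_zero this
        rw [hk, chainSum_nil_succ, map_zero, smul_zero]
      · rfl
  | cons z L ih =>
    rw [List.map_cons, List.prod_cons, ih (List.pairwise_cons.1 hL).2]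
    rcases hZ z with ⟨hp, h1, h2⟩ | ⟨hp, h⟩
    -- For a repeatable letter the recursion has the unknown series on both sides; solved for the
    -- shorter list, it shows that `1 - a` removes `z`.
    · have key : (1 - MvPowerSeries.C (ε • φ (word [z])) * MvPowerSeries.X j) *
          oneVar j (fun k => ε ^ k • φ (chainSum r p (z :: L) k)) =
          oneVar j fun k => ε ^ k • φ (chainSum r p L k) := by
        rw [sub_mul, one_mul, coeff_letter_mul_oneVar, sub_eq_iff_eq_add, ← oneVar_add]
        congr 1
        funext k
        cases k with
        | zero => simp [chainSum_zero]
        | succ k =>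
          rw [chainSum_cons_succ p hL, if_pos hp, map_add, map_mul]
          simp [pow_succ, mul_smul, -zsmul_eq_mul]
      rw [← key, ← mul_assoc, h1, one_mul]
    · rw [h, add_mul, one_mul, coeff_letter_mul_oneVar, ← oneVar_add]
      congr 1
      funext k
      cases k with
      | zero => simp [chainSum_zero]
      | succ k =>
        rw [chainSum_cons_succ p hL, if_neg hp, map_add, map_mul]
        simp [pow_succ, mul_smul, -zsmul_eq_mul]

end OneVariable

/-! ### Elementary and complete homogeneous functions as chain sums -/

section ElemHom

variable {N : ℕ} (o : ShuffleOrder N)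

/-- The strict order of a shuffle order. -/
def below (a b : Letter N) : Prop := o.lt a b

/-- The reverse of the strict order of a shuffle order. -/
def above (a b : Letter N) : Prop := o.lt b a

instance : IsStrictOrder (Letter N) (below o) :=
  letI := o.toLinearOrder
  inferInstanceAs (IsStrictOrder (Letter N) (· < ·))

instance : IsStrictOrder (Letter N) (above o) :=
  letI := o.toLinearOrder
  inferInstanceAs (IsStrictOrder (Letter N) (· > ·))

theorem elem_eq_chainSum {L : List (Letter N)} (hL : ∀ z, z ∈ L) (k : ℕ) :
    elem o k = chainSum (above o) IsBarred L k := by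
  have h : elem o k = wordSum (fun w => w.IsChain (ChainRel (above o) IsBarred)) k := by
    refine Finset.sum_congr rfl fun z _ => ?_
    by_cases h : (List.ofFn z).IsChain (ChainRel (above o) IsBarred)
    · rw [if_pos h]
      exact if_pos h
    · rw [if_neg h]
      exact if_neg h
  rw [h]
  refine wordSum_congr (fun w => ?_) k
  simp only [hL, implies_true, and_true]
  exact List.isChain_iff_pairwise

theorem hom_eq_chainSum {L : List (Letter N)} (hL : ∀ z, z ∈ L) (k : ℕ) :
    hom o k = chainSum (below o) IsPlain L k := by
  have h : hom o k = wordSum (fun w => w.IsChain (ChainRel (below o) IsPlain)) k := by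
    refine Finset.sum_congr rfl fun z _ => ?_
    by_cases h : (List.ofFn z).IsChain (ChainRel (below o) IsPlain)
    · rw [if_pos h]
      exact if_pos h
    · rw [if_neg h]
      exact if_neg h
  rw [h]
  refine wordSum_congr (fun w => ?_) k
  simp only [hL, implies_true, and_true]
  exact List.isChain_iff_pairwise

/-- The letters in increasing order. -/
noncomputable def letters : List (Letter N) :=
  letI := o.toLinearOrder
  (Finset.univ : Finset (Letter N)).sort (· ≤ ·)

theorem mem_letters (z : Letter N) : z ∈ letters o := by
  let _ := o.toLinearOrder
  rw [letters, Finset.mem_sort]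
  exact Finset.mem_univ z

theorem letters_pairwise : (letters o).Pairwise (below o) := by
  let _ := o.toLinearOrder
  exact (Finset.sortedLT_sort _).pairwise

theorem letters_reverse_pairwise : (letters o).reverse.Pairwise (above o) :=
  List.pairwise_reverse.2 (letters_pairwise o)

theorem elem_zero : elem o 0 = 1 := by
  rw [elem_eq_chainSum o (mem_letters o), chainSum_zero]

theorem hom_zero : hom o 0 = 1 := by
  rw [hom_eq_chainSum o (mem_letters o), chainSum_zero]

theorem not_isBarred_iff (z : Letter N) : ¬IsBarred z ↔ IsPlain z := by
  rcases z with a | a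
  · exact iff_of_true (fun ⟨b, h⟩ => Sum.inl_ne_inr h) ⟨a, rfl⟩
  · exact iff_of_false (fun h => h ⟨a, rfl⟩) fun ⟨b, h⟩ => Sum.inr_ne_inl h

theorem not_isPlain_iff (z : Letter N) : ¬IsPlain z ↔ IsBarred z := by
  rw [← not_isBarred_iff, not_not]

/-- The two products run in opposite orders, so inverse factors meet at the junction and cancel
outwards. -/
theorem prod_reverse_map_mul_prod_map {ι M : Type*} [Monoid M] {f g : ι → M}
    (h : ∀ i, f i * g i = 1) (L : List ι) : (L.reverse.map f).prod * (L.map g).prod = 1 := by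
  induction L with
  | nil => simp
  | cons a L ih =>
    rw [List.reverse_cons, List.map_append, List.prod_append, List.map_cons, List.prod_cons,
      List.map_cons, List.prod_cons, List.map_nil, List.prod_nil, mul_one, mul_assoc,
      ← mul_assoc (f a), h, one_mul, ih]

open scoped Classical in
/-- The factor `(1 - a)⁻¹` or `1 + a` for `a = c X j`. -/
noncomputable def factor {σ A : Type*} [Ring A] (b : Prop) (c : A) (j : σ) : MvPowerSeries σ A :=
  if b then MvPowerSeries.invOfUnit (1 - MvPowerSeries.C c * MvPowerSeries.X j) 1
  else 1 + MvPowerSeries.C c * MvPowerSeries.X j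

theorem isFactor_factor {σ A : Type*} [Ring A] (b : Prop) (c : A) (j : σ) :
    IsFactor b (MvPowerSeries.C c * MvPowerSeries.X j) (factor b c j) := by
  by_cases h : b
  · refine Or.inl ⟨h, ?_, ?_⟩ <;> rw [factor, if_pos h]
    · exact MvPowerSeries.invOfUnit_mul _ _ (by simp)
    · exact MvPowerSeries.mul_invOfUnit _ _ (by simp)
  · exact Or.inr ⟨h, by rw [factor, if_neg h]⟩

/-- `E(-x) H(x) = 1`. -/
theorem sum_antidiagonal_elem_mul_hom {n : ℕ} (hn : n ≠ 0) :
    ∑ i ∈ Finset.HasAntidiagonal.antidiagonal n, ((-1 : ℤ) ^ i.1 • elem o i.1) * hom o i.2 = 0 := by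
  have hE := prod_factors_eq_oneVar (r := above o) IsBarred (RingHom.id (FreeAlg N)) (-1) ()
    (fun z => factor (IsBarred z) ((-1 : ℤ) • word [z]) ())
    (fun z => isFactor_factor _ _ _) (letters_reverse_pairwise o)
  have hH := prod_factors_eq_oneVar (r := below o) IsPlain (RingHom.id (FreeAlg N)) 1 ()
    (fun z => factor (IsPlain z) ((1 : ℤ) • word [z]) ())
    (fun z => isFactor_factor _ _ _) (letters_pairwise o)
  -- Letter by letter, the factor of `E` at `-x` is inverse to the factor of `H` at `x`: they are
  -- `(1 + u x)⁻¹` and `1 + u x` for a barred letter, `1 - u x` and `(1 - u x)⁻¹` for an unbarred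
  -- one.
  have key := prod_reverse_map_mul_prod_map
    (f := fun z : Letter N => factor (IsBarred z) ((-1 : ℤ) • word [z]) ())
    (g := fun z : Letter N => factor (IsPlain z) ((1 : ℤ) • word [z]) ()) (fun z => by
      have h1 := isFactor_factor (IsBarred z) ((-1 : ℤ) • word [z]) ()
      have h2 := isFactor_factor (IsPlain z) ((1 : ℤ) • word [z]) ()
      rcases h1 with ⟨hb, h1, h1'⟩ | ⟨hb, h1⟩ <;> rcases h2 with ⟨hp, h2, h2'⟩ | ⟨hp, h2⟩
      · exact absurd hb ((not_isBarred_iff z).2 hp)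
      · rw [h2]
        simpa using h1
      · rw [h1]
        simpa [sub_eq_add_neg] using h2'
      · exact absurd ((not_isPlain_iff z).1 hp) hb) (letters o)
  rw [hE, hH] at key
  -- With index type `Unit` every exponent is a multiple of the single variable, so the series is an
  -- ordinary power series.
  have hmk : ∀ f : ℕ → FreeAlg N, oneVar () f = PowerSeries.mk f := by
    intro f
    refine MvPowerSeries.ext fun m => ?_
    have hm : m = Finsupp.single () (m ()) := by ext; simp
    rw [coeff_oneVar, if_pos hm]
    rfl
  rw [hmk, hmk] at key
  have := congrArg (PowerSeries.coeff n) key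
  rw [PowerSeries.coeff_mul, PowerSeries.coeff_one, if_neg hn] at this
  rw [← this]
  refine Finset.sum_congr rfl fun i _ => ?_
  rw [PowerSeries.coeff_mk, PowerSeries.coeff_mk,
    elem_eq_chainSum o (L := (letters o).reverse) (fun z => by simp [mem_letters]),
    hom_eq_chainSum o (mem_letters o)]
  simp

end ElemHom

/-! ### Passing commutation between the `e_k` and the `h_k` -/

section Commutation

variable {A : Type*} [Ring A] {a b : ℕ → A}

/-- Since `a 0 = 1`, the relation expresses `b n` through the `a i` and the earlier `b i`. -/
theorem commute_right_of_sum_antidiagonal_eq_zero (ha : a 0 = 1) (hb : b 0 = 1)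
    (h : ∀ n ≠ 0, ∑ i ∈ Finset.HasAntidiagonal.antidiagonal n, a i.1 * b i.2 = 0) {x : A}
    (hx : ∀ k, Commute x (a k)) (k : ℕ) : Commute x (b k) := by
  induction k using Nat.strong_induction_on with
  | _ n ih =>
    cases n with
    | zero => rw [hb]; exact Commute.one_right x
    | succ n =>
      have := h (n + 1) (by omega)
      rw [Finset.Nat.antidiagonal_succ, Finset.sum_cons, ha, one_mul] at this
      rw [eq_neg_of_add_eq_zero_left this]
      refine (Commute.sum_right _ _ _ fun i hi => (hx _).mul_right (ih _ ?_)).neg_right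
      simp only [Finset.mem_map, Finset.HasAntidiagonal.mem_antidiagonal] at hi
      obtain ⟨j, hj, rfl⟩ := hi
      simp
      omega

theorem commute_left_of_sum_antidiagonal_eq_zero (ha : a 0 = 1) (hb : b 0 = 1)
    (h : ∀ n ≠ 0, ∑ i ∈ Finset.HasAntidiagonal.antidiagonal n, a i.1 * b i.2 = 0) {x : A}
    (hx : ∀ k, Commute x (b k)) (k : ℕ) : Commute x (a k) := by
  induction k using Nat.strong_induction_on with
  | _ n ih =>
    cases n with
    | zero => rw [ha]; exact Commute.one_right x
    | succ n =>
      have := h (n + 1) (by omega)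
      rw [Finset.Nat.antidiagonal_succ', Finset.sum_cons, hb, mul_one] at this
      rw [eq_neg_of_add_eq_zero_left this]
      refine (Commute.sum_right _ _ _ fun i hi => (ih _ ?_).mul_right (hx _)).neg_right
      simp only [Finset.mem_map, Finset.HasAntidiagonal.mem_antidiagonal] at hi
      obtain ⟨j, hj, rfl⟩ := hi
      simp
      omega

variable {N : ℕ} (o : ShuffleOrder N) (I : Ideal (FreeAlg N)) [I.IsTwoSided]

theorem sum_antidiagonal_mk_elem_mul_mk_hom {n : ℕ} (hn : n ≠ 0) :
    ∑ i ∈ Finset.HasAntidiagonal.antidiagonal n, ((-1 : ℤ) ^ i.1 •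
      Ideal.Quotient.mk I (elem o i.1)) * Ideal.Quotient.mk I (hom o i.2) = 0 := by
  have := congrArg (Ideal.Quotient.mk I) (sum_antidiagonal_elem_mul_hom o hn)
  rw [map_sum, map_zero] at this
  rw [← this]
  refine Finset.sum_congr rfl fun i _ => ?_
  rw [map_mul, map_zsmul]

theorem commute_zsmul_elem_iff (x : FreeAlg N ⧸ I) (k : ℕ) :
    Commute x ((-1 : ℤ) ^ k • Ideal.Quotient.mk I (elem o k)) ↔
      Commute x (Ideal.Quotient.mk I (elem o k)) := by
  rcases neg_one_pow_eq_or ℤ k with h | h <;> simp [h]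

theorem elemCommute_iff_homCommute : ElemCommute o I ↔ HomCommute o I := by
  have ha : (-1 : ℤ) ^ 0 • Ideal.Quotient.mk I (elem o 0) = 1 := by simp [elem_zero]
  have hb : Ideal.Quotient.mk I (hom o 0) = 1 := by simp [hom_zero]
  have h := fun n => sum_antidiagonal_mk_elem_mul_mk_hom o I (n := n)
  constructor
  · intro hc
    -- The transfer is used twice, through the mixed commutation of an `e` with an `h`.
    have h1 : ∀ k l, Commute (Ideal.Quotient.mk I (elem o k)) (Ideal.Quotient.mk I (hom o l)) :=
      fun k => commute_right_of_sum_antidiagonal_eq_zero ha hb h fun l =>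
        (commute_zsmul_elem_iff o I _ l).2 (hc k l)
    exact fun k => commute_right_of_sum_antidiagonal_eq_zero ha hb h fun l =>
        (commute_zsmul_elem_iff o I _ l).2 (h1 l k).symm
  · intro hc
    have h1 : ∀ k l, Commute (Ideal.Quotient.mk I (hom o k)) (Ideal.Quotient.mk I (elem o l)) :=
      fun k l => (commute_zsmul_elem_iff o I _ l).1
        (commute_left_of_sum_antidiagonal_eq_zero
          (a := fun i => (-1 : ℤ) ^ i • Ideal.Quotient.mk I (elem o i)) ha hb h (fun l => hc k l) l)
    exact fun k l => (commute_zsmul_elem_iff o I _ l).1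
        (commute_left_of_sum_antidiagonal_eq_zero
          (a := fun i => (-1 : ℤ) ^ i • Ideal.Quotient.mk I (elem o i)) ha hb h
          (fun l => (h1 l k).symm) l)

end Commutation

/-! ### Commutation of ordered products -/

section OrderedProducts

variable {S : Type*} [Ring S]

/-- Moving `y` across a factor costs one commutator `g = z y - y z`. The quadratic term in `s`,
which is `z g` for an inverted factor and `g z` for a linear one, is killed by hypothesis. -/
theorem IsFactor.mul_eq_add_mul {b : Prop} {s z Z y : S} (hs : ∀ a, s * a = a * s)
    (hZ : IsFactor b (z * s) Z) (hb : b → z * (z * y - y * z) = 0)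
    (hb' : ¬b → (z * y - y * z) * z = 0) :
    Z * y = (y + (z * y - y * z) * s) * Z := by
  generalize hg : z * y - y * z = g at *
  rcases hZ with ⟨h, h1, h2⟩ | ⟨h, rfl⟩
  · have key : (1 - z * s) * (y + g * s) = y * (1 - z * s) := by
      have e1 : z * s * (g * s) = 0 := by
        rw [← mul_assoc, mul_assoc z, hs g, ← mul_assoc z, hb h, zero_mul, zero_mul]
      have e2 : z * s * y = z * y * s := by rw [mul_assoc, hs y, mul_assoc]
      have e3 : y * (z * s) = y * z * s := by rw [mul_assoc]
      rw [sub_mul, one_mul, mul_add, e1, e2, add_zero, mul_sub, mul_one, e3, ← hg, sub_mul]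
      abel
    calc Z * y = Z * (y * (1 - z * s)) * Z := by rw [mul_assoc, mul_assoc y, h2, mul_one]
      _ = (y + g * s) * Z := by rw [← key, ← mul_assoc Z, h1, one_mul]
  · have e1 : g * s * (z * s) = 0 := by
      rw [← mul_assoc, mul_assoc g, hs z, ← mul_assoc g, hb' h, zero_mul, zero_mul]
    have e2 : z * s * y = z * y * s := by rw [mul_assoc, hs y, mul_assoc]
    have e3 : y * (z * s) = y * z * s := by rw [mul_assoc]
    rw [mul_add, mul_one, add_mul y, e1, e3, add_zero, add_mul, one_mul, e2, ← hg, sub_mul]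
    abel

theorem IsFactor.commute {b : Prop} {s z Z y : S} (hs : ∀ a, s * a = a * s)
    (hZ : IsFactor b (z * s) Z) (h : Commute z y) : Commute Z y := by
  have h0 : z * y - y * z = 0 := sub_eq_zero.2 h
  have := hZ.mul_eq_add_mul (y := y) hs (by simp [h0]) (by simp [h0])
  rwa [h0, zero_mul, add_zero] at this

/-- Moving `A` past `1 + y t` leaves `(1 + y s)(1 + (y + g s) t) A A'`. Its only asymmetric term is
`y g s² t`, which vanishes. -/
theorem commute_mul_of_plain {s t y g A A' : S} (hs : ∀ a, s * a = a * s)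
    (ht : ∀ a, t * a = a * t) (hA : Commute A A') (h : A * y = (y + g * s) * A)
    (h' : A' * y = (y + g * t) * A') (hg : y * g = 0) :
    Commute ((1 + y * s) * A) ((1 + y * t) * A') := by
  have key : ∀ {s t A A' : S}, (∀ a, s * a = a * s) → (∀ a, t * a = a * t) →
      A * y = (y + g * s) * A →
      (1 + y * s) * A * ((1 + y * t) * A') =
        (1 + y * s + y * t + y * y * (s * t) + g * (s * t)) * (A * A') := by
    intro s t A A' hs ht h
    have e1 : A * (1 + y * t) = (1 + (y + g * s) * t) * A := by
      rw [mul_add, mul_one, ← mul_assoc, h, add_mul 1, one_mul, mul_assoc, ← ht A, mul_assoc]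
    have e2 : (1 + y * s) * (1 + (y + g * s) * t) =
        1 + y * s + y * t + y * y * (s * t) + g * (s * t) := by
      have e3 : y * s * (y * t) = y * y * (s * t) := by
        rw [mul_assoc, ← mul_assoc s, hs y]; simp only [mul_assoc]
      have e4 : y * s * (g * s * t) = 0 := by
        rw [mul_assoc, ← mul_assoc s, ← mul_assoc s, hs g]
        simp only [← mul_assoc]
        rw [hg]; simp
      rw [add_mul y (g * s) t, mul_add, mul_add, add_mul, add_mul, add_mul, e3, e4, mul_one,
        mul_one, one_mul, one_mul, mul_assoc g]
      abel
    rw [mul_assoc, ← mul_assoc A, e1, mul_assoc, ← mul_assoc, e2]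
  change _ * _ = _ * _
  rw [key hs ht h, key ht hs h', hA.eq, hs t, add_right_comm 1]

/-- Here the denominators are cleared: `D = (1 - (y + g s) t)(1 - y s)` carries `Y A Y' A'` to `A
A'`, and because `g y = 0` it is symmetric in `s` and `t`. As `D` is a unit it can be cancelled. -/
theorem commute_mul_of_barred {s t y g A A' Y Y' : S} (hs : ∀ a, s * a = a * s)
    (ht : ∀ a, t * a = a * t) (hA : Commute A A') (hu : IsUnit A)
    (hY : (1 - y * s) * Y = 1) (hY' : (1 - y * t) * Y' = 1)
    (hsu : IsUnit (1 - y * s)) (htu : IsUnit (1 - y * t)) (h : A * y = (y + g * s) * A)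
    (h' : A' * y = (y + g * t) * A') (hg : g * y = 0) :
    Commute (Y * A) (Y' * A') := by
  have hD : ∀ {s t : S}, (∀ a, s * a = a * s) → (∀ a, t * a = a * t) →
      (1 - (y + g * s) * t) * (1 - y * s) = 1 - y * s - y * t + y * y * (s * t) - g * (s * t) := by
    intro s t hs ht
    have e3 : y * t * (y * s) = y * y * (s * t) := by
      rw [mul_assoc, ← mul_assoc t, ht y, hs t]; simp only [mul_assoc]
    have e4 : g * s * t * (y * s) = 0 := by
      rw [mul_assoc g, mul_assoc g, ← mul_assoc (s * t), mul_assoc s, ht y, ← mul_assoc s, hs y]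
      simp only [← mul_assoc]
      rw [hg]; simp
    rw [add_mul y (g * s) t, mul_sub, mul_one, sub_mul, add_mul, one_mul, e3, e4, mul_assoc g]
    abel
  have hZ : ∀ {s t A : S}, (∀ a, t * a = a * t) → A * y = (y + g * s) * A →
      (1 - (y + g * s) * t) * A = A * (1 - y * t) := by
    intro s t A ht h
    rw [mul_sub, mul_one, ← mul_assoc A, h, sub_mul, one_mul, mul_assoc _ t, ht A, mul_assoc]
  have key : ∀ {s t A A' Y Y' : S}, (∀ a, s * a = a * s) → (∀ a, t * a = a * t) →
      A * y = (y + g * s) * A → (1 - y * s) * Y = 1 → (1 - y * t) * Y' = 1 →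
      (1 - y * s - y * t + y * y * (s * t) - g * (s * t)) * (Y * A * (Y' * A')) = A * A' := by
    intro s t A A' Y Y' hs ht h hY hY'
    rw [← hD hs ht, mul_assoc, mul_assoc Y, ← mul_assoc (1 - y * s), hY, one_mul, ← mul_assoc,
      hZ ht h, mul_assoc, ← mul_assoc _ Y', hY', one_mul]
  -- The left factor of `D` is the conjugate of the unit `1 - y t` by `A`.
  have hunit : IsUnit (1 - y * s - y * t + y * y * (s * t) - g * (s * t)) := by
    rw [← hD hs ht]
    refine IsUnit.mul ?_ hsu
    obtain ⟨a, rfl⟩ := hu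
    rw [← Units.isUnit_mul_units _ a, hZ ht h]
    exact a.isUnit.mul htu
  apply hunit.mul_left_cancel
  rw [key hs ht h hY hY', sub_right_comm 1, hs t, key ht hs h' hY' hY, hA.eq]

/-- The product `Z (n - 1) ⋯ Z 1 * Z 0`. -/
def descendingProd (Z : ℕ → S) : ℕ → S
  | 0 => 1
  | n + 1 => Z n * descendingProd Z n

theorem descendingProd_eq_prod (Z : ℕ → S) (n : ℕ) :
    descendingProd Z n = ((List.range n).reverse.map Z).prod := by
  induction n with
  | zero => rfl
  | succ n ih => rw [List.range_succ, List.reverse_concat, List.map_cons, List.prod_cons, ← ih]; rfl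

/-- The relations of `I_kron` for letters `v 0, v 1, …, v (m - 1)` in increasing order, where `b n`
says whether the letter `v n` is barred. -/
structure KronLetters (v : ℕ → S) (b : ℕ → Prop) (m : ℕ) : Prop where
  upper_plain : ∀ i j, i < j → j < m → ¬b j → v j * (v i * v j - v j * v i) = 0
  upper_barred : ∀ i j, i < j → j < m → b j → (v i * v j - v j * v i) * v j = 0
  lower_plain : ∀ i j, i < j → j < m → ¬b i → (v i * v j - v j * v i) * v i = 0
  lower_barred : ∀ i j, i < j → j < m → b i → v i * (v i * v j - v j * v i) = 0
  rotate : ∀ i, i + 2 < m → Commute (v (i + 1)) (v i * v (i + 2) - v (i + 2) * v i)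
  far : ∀ i j, i + 3 ≤ j → j < m → Commute (v i) (v j)

/-- The commutator defect of the letter `v n` with the product of the factors of smaller letters. -/
def defect (v : ℕ → S) : ℕ → S
  | 0 => 0
  | 1 => v 0 * v 1 - v 1 * v 0
  | n + 2 => v (n + 1) * v (n + 2) - v (n + 2) * v (n + 1) + (v n * v (n + 2) - v (n + 2) * v n)

variable {v : ℕ → S} {b : ℕ → Prop} {m : ℕ}

theorem KronLetters.mul_defect (hv : KronLetters v b m) {n : ℕ} (hn : n < m) (h : ¬b n) :
    v n * defect v n = 0 := by
  match n with
  | 0 => rw [defect, mul_zero]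
  | 1 => exact hv.upper_plain 0 1 (by omega) hn h
  | n + 2 =>
    rw [defect, mul_add, hv.upper_plain _ _ (by omega) hn h, hv.upper_plain _ _ (by omega) hn h,
      add_zero]

theorem KronLetters.defect_mul (hv : KronLetters v b m) {n : ℕ} (hn : n < m) (h : b n) :
    defect v n * v n = 0 := by
  match n with
  | 0 => rw [defect, zero_mul]
  | 1 => exact hv.upper_barred 0 1 (by omega) hn h
  | n + 2 =>
    rw [defect, add_mul, hv.upper_barred _ _ (by omega) hn h, hv.upper_barred _ _ (by omega) hn h,
      add_zero]

theorem KronLetters.factor_mul (hv : KronLetters v b m) {s Z : S} (hs : ∀ a, s * a = a * s)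
    {i j : ℕ} (hij : i < j) (hj : j < m) (hZ : IsFactor (b i) (v i * s) Z) :
    Z * v j = (v j + (v i * v j - v j * v i) * s) * Z :=
  hZ.mul_eq_add_mul hs (hv.lower_barred i j hij hj) (hv.lower_plain i j hij hj)

/-- Only the two letters directly below `v n` fail to commute with it. The commutator created by the
lower of these commutes with the upper one by `rotate`, so it passes on unchanged and the defects
add up, linearly in `s`. -/
theorem KronLetters.descendingProd_mul (hv : KronLetters v b m) {s : S} (hs : ∀ a, s * a = a * s)
    {Z : ℕ → S} (hZ : ∀ n, IsFactor (b n) (v n * s) (Z n)) {n : ℕ} (hn : n < m) :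
    descendingProd Z n * v n = (v n + defect v n * s) * descendingProd Z n := by
  match n with
  | 0 => simp [descendingProd, defect]
  | 1 =>
    simp only [descendingProd, mul_one]
    exact hv.factor_mul hs (by omega) hn (hZ 0)
  | n + 2 =>
    have hfar : ∀ k ≤ n, Commute (descendingProd Z k) (v (n + 2)) := by
      intro k
      induction k with
      | zero => exact fun _ => Commute.one_left _
      | succ k ih =>
        intro hk
        exact ((hZ k).commute hs (hv.far k (n + 2) (by omega) hn)).mul_left (ih (by omega))
    have h1 := hv.factor_mul hs (show n + 1 < n + 2 by omega) hn (hZ (n + 1))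
    have h2 := hv.factor_mul hs (show n < n + 2 by omega) hn (hZ n)
    have h3 := ((hZ (n + 1)).commute hs (hv.rotate n hn)).eq
    simp only [descendingProd, defect]
    rw [mul_assoc, mul_assoc, (hfar n le_rfl).eq, ← mul_assoc (Z n), h2, ← mul_assoc,
      ← mul_assoc, ← mul_assoc, mul_add (Z (n + 1)), h1, ← mul_assoc (Z (n + 1)), h3,
      mul_assoc _ (Z (n + 1)) s, ← hs (Z (n + 1)), ← mul_assoc _ s, ← add_mul, add_assoc,
      ← add_mul]
    simp only [mul_assoc]

theorem KronLetters.commute_descendingProd (hv : KronLetters v b m) {s t : S}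
    (hs : ∀ a, s * a = a * s) (ht : ∀ a, t * a = a * t) {Z Z' : ℕ → S}
    (hZ : ∀ n, IsFactor (b n) (v n * s) (Z n)) (hZ' : ∀ n, IsFactor (b n) (v n * t) (Z' n))
    (hu : ∀ n, IsUnit (Z n)) {n : ℕ} (hn : n ≤ m) :
    Commute (descendingProd Z n) (descendingProd Z' n) := by
  have hunit : ∀ n, IsUnit (descendingProd Z n) := by
    intro n
    induction n with
    | zero => exact isUnit_one
    | succ n ih => exact (hu n).mul ih
  induction n with
  | zero => exact Commute.one_left _
  | succ n ih =>
    have hc := ih (by omega)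
    have h := hv.descendingProd_mul hs hZ hn
    have h' := hv.descendingProd_mul ht hZ' hn
    simp only [descendingProd]
    rcases hZ n with ⟨hb, h1, h2⟩ | ⟨hb, h1⟩ <;> rcases hZ' n with ⟨hb', h1', h2'⟩ | ⟨hb', h1'⟩
    · exact commute_mul_of_barred hs ht hc (hunit n) h2 h2' ⟨⟨_, _, h2, h1⟩, rfl⟩
        ⟨⟨_, _, h2', h1'⟩, rfl⟩ h h' (hv.defect_mul hn hb)
    · exact absurd hb hb'
    · exact absurd hb' hb
    · rw [h1, h1']
      exact commute_mul_of_plain hs ht hc h h' (hv.mul_defect hn hb)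

end OrderedProducts

/-! ### Coefficients of products of one-variable series in different variables -/

theorem coeff_mul_oneVar {σ A : Type*} [Ring A] (j : σ) (f : ℕ → A) {G : MvPowerSeries σ A}
    (hG : ∀ m : σ →₀ ℕ, m j ≠ 0 → MvPowerSeries.coeff m G = 0) (m : σ →₀ ℕ) :
    MvPowerSeries.coeff m (G * oneVar j f) = MvPowerSeries.coeff (m.erase j) G * f (m j) := by
  classical
  rw [MvPowerSeries.coeff_mul, Finset.sum_eq_single (m.erase j, Finsupp.single j (m j))]
  · rw [coeff_oneVar, if_pos (by simp)]
    simp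
  · rintro ⟨p, q⟩ hpq hne
    rw [Finset.HasAntidiagonal.mem_antidiagonal] at hpq
    simp only at hpq
    subst hpq
    by_cases hp : p j = 0
    · rw [coeff_oneVar]
      by_cases hq : q = Finsupp.single j (q j)
      · exfalso
        apply hne
        have h1 : q = Finsupp.single j ((p + q) j) := by rw [Finsupp.add_apply, hp, zero_add, ← hq]
        have h2 : p = (p + q).erase j := by
          ext i
          by_cases hi : i = j
          · subst hi; simp [hp]
          · rw [Finsupp.erase_ne hi, hq]
            simp [hi]
        rw [← h1, ← h2]
      · simp only [if_neg hq, mul_zero]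
    · simp only [hG p hp, zero_mul]
  · intro h
    refine absurd ?_ h
    rw [Finset.HasAntidiagonal.mem_antidiagonal, add_comm, Finsupp.single_add_erase]

theorem coeff_oneVar_of_ne {σ A : Type*} [Ring A] {i j : σ} (hij : i ≠ j) (f : ℕ → A)
    (m : σ →₀ ℕ) (hm : m j ≠ 0) : MvPowerSeries.coeff m (oneVar i f) = 0 := by
  rw [coeff_oneVar, if_neg]
  intro h
  rw [h, Finsupp.single_eq_of_ne' hij] at hm
  exact hm rfl

/-- The coefficient of `X_0^k X_1^l` is `f k * f l` in one order of the product and `f l * f k` in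
the other. -/
theorem commute_of_commute_oneVar {A : Type*} [Ring A] {f : ℕ → A}
    (h : Commute (oneVar (0 : Fin 2) f) (oneVar (1 : Fin 2) f)) (k l : ℕ) :
    Commute (f k) (f l) := by
  have := congrArg (MvPowerSeries.coeff (Finsupp.single 0 k + Finsupp.single 1 l)) h.eq
  rw [coeff_mul_oneVar _ _ (coeff_oneVar_of_ne (by decide) f),
    coeff_mul_oneVar _ _ (coeff_oneVar_of_ne (by decide) f), coeff_oneVar, coeff_oneVar,
    if_pos, if_pos] at this
  · simpa [Commute, SemiconjBy] using this
  · ext i; fin_cases i <;> simp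
  · ext i; fin_cases i <;> simp

/-! ### The elementary functions commute modulo `I_kron` -/

section Kron

variable {M : ℕ}

/-- The letter of rank `n` in the natural order. -/
def letterOfRank (M n : ℕ) : Letter (M + 1) :=
  if n % 2 = 0 then plain (Fin.ofNat (M + 1) (n / 2)) else barred (Fin.ofNat (M + 1) (n / 2))

theorem naturalRank_letterOfRank {n : ℕ} (hn : n < 2 * (M + 1)) :
    naturalRank (letterOfRank M n) = n := by
  have h : n / 2 % (M + 1) = n / 2 := Nat.mod_eq_of_lt (by omega)
  rw [letterOfRank]
  split_ifs with h2
  · change 2 * (n / 2 % (M + 1)) = n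
    omega
  · change 2 * (n / 2 % (M + 1)) + 1 = n
    omega

theorem isDown_letterOfRank {n : ℕ} (hn : n + 1 < 2 * (M + 1)) :
    IsDown (letterOfRank M (n + 1)) (letterOfRank M n) := by
  have h : n / 2 % (M + 1) = n / 2 := Nat.mod_eq_of_lt (by omega)
  have h' : (n + 1) / 2 % (M + 1) = (n + 1) / 2 := Nat.mod_eq_of_lt (by omega)
  rcases Nat.mod_two_eq_zero_or_one n with h2 | h2
  · right
    refine ⟨Fin.ofNat (M + 1) (n / 2), ?_, ?_⟩
    · rw [letterOfRank, if_neg (by omega), show (n + 1) / 2 = n / 2 by omega]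
    · rw [letterOfRank, if_pos h2]
  · left
    refine ⟨Fin.ofNat (M + 1) (n / 2), Fin.ofNat (M + 1) ((n + 1) / 2), ?_, ?_, ?_⟩
    · change (n + 1) / 2 % (M + 1) = n / 2 % (M + 1) + 1
      omega
    · rw [letterOfRank, if_pos (by omega)]
    · rw [letterOfRank, if_neg (by omega)]

theorem letterOfRank_lt {i j : ℕ} (hij : i < j) (hj : j < 2 * (M + 1)) :
    (naturalOrder (M + 1)).lt (letterOfRank M i) (letterOfRank M j) := by
  change naturalRank _ < naturalRank _
  rwa [naturalRank_letterOfRank hj, naturalRank_letterOfRank (hij.trans hj)]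

theorem exists_letterOfRank (z : Letter (M + 1)) :
    ∃ n < 2 * (M + 1), letterOfRank M n = z := by
  have hz : naturalRank z < 2 * (M + 1) := by
    rcases z with a | a <;> simp only [naturalRank] <;> omega
  exact ⟨_, hz, naturalRank_injective (naturalRank_letterOfRank hz)⟩

theorem map_eq_zero_of_kronRel {N : ℕ} {f : FreeAlg N} (hf : KronRel N f) :
    Ideal.Quotient.mk (kronIdeal N) f = 0 :=
  Ideal.Quotient.eq_zero_iff_mem.2 (TwoSidedIdeal.mem_asIdeal.2 (TwoSidedIdeal.subset_span hf))

/-- The target ring is left general because the letters are needed as constants in power series over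
`𝒰/I_kron`, where central variables are available. -/
theorem kronLetters_letterOfRank {S : Type*} [Ring S] (ψ : FreeAlg (M + 1) →+* S)
    (hψ : ∀ f, KronRel (M + 1) f → ψ f = 0) :
    KronLetters (fun n => ψ (word [letterOfRank M n])) (fun n => IsBarred (letterOfRank M n))
      (2 * (M + 1)) := by
  have h2 : ∀ x y : Letter (M + 1), word [x, y] = word [x] * word [y] := fun x y =>
    word_append [x] [y]
  have h3 : ∀ x y z : Letter (M + 1), word [x, y, z] = word [x] * (word [y] * word [z]) :=
    fun x y z => by rw [← h2, ← word_append]; rfl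
  constructor
  · intro i j hij hj hb
    have := hψ _ (KronRel.yyx _ _ (not_not.1 ((not_isPlain_iff _).not.2 hb))
      (letterOfRank_lt hij hj))
    rw [h3, h3, map_sub, sub_eq_zero] at this
    simp only [map_mul] at this
    rw [mul_sub, this, sub_self]
  · intro i j hij hj hb
    have := hψ _ (KronRel.xyy _ _ hb (letterOfRank_lt hij hj))
    rw [h3, h3, map_sub, sub_eq_zero] at this
    simp only [map_mul] at this
    rw [sub_mul, mul_assoc, mul_assoc, this, sub_self]
  · intro i j hij hj hb
    have := hψ _ (KronRel.zyy _ _ (not_not.1 ((not_isPlain_iff _).not.2 hb))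
      (letterOfRank_lt hij hj))
    rw [h3, h3, map_sub, sub_eq_zero] at this
    simp only [map_mul] at this
    rw [sub_mul, mul_assoc, mul_assoc, this, sub_self]
  · intro i j hij hj hb
    have := hψ _ (KronRel.yyz _ _ hb (letterOfRank_lt hij hj))
    rw [h3, h3, map_sub, sub_eq_zero] at this
    simp only [map_mul] at this
    rw [mul_sub, this, sub_self]
  · intro i hi
    have := hψ _ (KronRel.rotate _ _ _ (isDown_letterOfRank (M := M) (n := i) (by omega))
      (isDown_letterOfRank (n := i + 1) hi))
    rw [h2, h2, map_sub, sub_eq_zero] at this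
    simp only [map_mul, map_sub] at this
    exact this.symm
  · intro i j hij hj
    -- The letter two steps below rank `j` has rank `k`, and `i + 3 ≤ j` says that `i < k`.
    obtain ⟨k, rfl⟩ : ∃ k, j = k + 2 := ⟨j - 2, by omega⟩
    have := hψ _ (KronRel.far _ _ _ _ (isDown_letterOfRank (M := M) (n := k + 1) hj)
      (isDown_letterOfRank (n := k) (by omega)) (letterOfRank_lt (i := i) (by omega) (by omega)))
    rw [h2, h2, map_sub, sub_eq_zero] at this
    simp only [map_mul] at this
    exact this

theorem elemCommute_kronIdeal (N : ℕ) : ElemCommute (naturalOrder N) (kronIdeal N) := by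
  cases N with
  | zero =>
    -- Without letters, `letterOfRank` is not available and the empty word is the only chain.
    have h : ∀ k, elem (naturalOrder 0) k = if k = 0 then 1 else 0 := by
      intro k
      rw [elem_eq_chainSum _ (L := []) (fun z => by rcases z with z | z <;> exact z.elim0)]
      cases k with
      | zero => rw [chainSum_zero, if_pos rfl]
      | succ k => rw [chainSum_nil_succ, if_neg (by omega)]
    intro k l
    rw [h]
    split_ifs
    · rw [map_one]; exact Commute.one_left _
    · rw [map_zero]; exact Commute.zero_left _
  | succ M =>
    let A := FreeAlg (M + 1) ⧸ kronIdeal (M + 1)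
    -- The two variables play the roles of the central elements `s` and `t`.
    let ψ : FreeAlg (M + 1) →+* MvPowerSeries (Fin 2) A :=
      MvPowerSeries.C.comp (Ideal.Quotient.mk (kronIdeal (M + 1)))
    have hv := kronLetters_letterOfRank ψ fun f hf => by
      rw [RingHom.comp_apply, map_eq_zero_of_kronRel hf, map_zero]
    let Z : Fin 2 → Letter (M + 1) → MvPowerSeries (Fin 2) A := fun j z =>
      factor (IsBarred z) (Ideal.Quotient.mk (kronIdeal (M + 1)) (word [z])) j
    have hX : ∀ (j : Fin 2) (a : MvPowerSeries (Fin 2) A),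
        MvPowerSeries.X j * a = a * MvPowerSeries.X j := fun j a => MvPowerSeries.X_mul
    have hZ : ∀ j n, IsFactor (IsBarred (letterOfRank M n))
        (ψ (word [letterOfRank M n]) * MvPowerSeries.X j) (Z j (letterOfRank M n)) :=
      fun j n => isFactor_factor _ _ _
    have hu : ∀ n, IsUnit (Z 0 (letterOfRank M n)) := by
      intro n
      rcases hZ 0 n with ⟨-, h1, h2⟩ | ⟨-, h⟩
      · exact ⟨⟨_, _, h1, h2⟩, rfl⟩
      · rw [h, MvPowerSeries.isUnit_iff_constantCoeff]
        simp
    have hc := hv.commute_descendingProd (hX 0) (hX 1) (hZ 0) (hZ 1) hu le_rfl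
    have hL : ((List.range (2 * (M + 1))).map (letterOfRank M)).reverse.Pairwise
        (above (naturalOrder (M + 1))) := by
      rw [List.pairwise_reverse, List.pairwise_map]
      refine List.pairwise_lt_range.imp_of_mem ?_
      intro i j _ hj hij
      exact letterOfRank_lt hij (List.mem_range.1 hj)
    have hmem : ∀ z, z ∈ ((List.range (2 * (M + 1))).map (letterOfRank M)).reverse := by
      intro z
      obtain ⟨n, hn, rfl⟩ := exists_letterOfRank z
      exact List.mem_reverse.2 (List.mem_map_of_mem (List.mem_range.2 hn))
    have hE : ∀ j, descendingProd (fun n => Z j (letterOfRank M n)) (2 * (M + 1)) =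
        oneVar j fun k =>
          Ideal.Quotient.mk (kronIdeal (M + 1)) (elem (naturalOrder (M + 1)) k) := by
      intro j
      have := prod_factors_eq_oneVar IsBarred (Ideal.Quotient.mk (kronIdeal (M + 1))) 1 j (Z j)
        (fun z => by rw [one_smul]; exact isFactor_factor _ _ _) hL
      rw [descendingProd_eq_prod]
      simp only [one_pow, one_smul, ← elem_eq_chainSum _ hmem] at this
      rw [← this, ← List.map_reverse, List.map_map]
      rfl
    rw [hE, hE] at hc
    exact commute_of_commute_oneVar hc

end Kron

/-! ### The Cauchy product -/

section Cauchy

variable {N : ℕ} (o : ShuffleOrder N)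

theorem isFactor_cauchyFactor (z : Letter N) (j : ℕ) :
    IsFactor (IsPlain z) (MvPowerSeries.C (word [z]) * MvPowerSeries.X j) (cauchyFactor z j) := by
  by_cases h : IsBarred z
  · exact Or.inr ⟨(not_isPlain_iff z).2 h, by rw [cauchyFactor, if_pos h]⟩
  · refine Or.inl ⟨(not_isBarred_iff z).1 h, ?_, ?_⟩ <;> rw [cauchyFactor, if_neg h]
    · exact MvPowerSeries.invOfUnit_mul _ _ (by simp)
    · exact MvPowerSeries.mul_invOfUnit _ _ (by simp)

theorem prod_cauchyFactor (j : ℕ) :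
    ((letters o).map fun z => cauchyFactor z j).prod = oneVar j (hom o) := by
  have := prod_factors_eq_oneVar IsPlain (RingHom.id (FreeAlg N)) 1 j
    (fun z => cauchyFactor z j) (fun z => by rw [one_smul]; exact isFactor_cauchyFactor z j)
    (letters_pairwise o)
  rw [this]
  congr 1
  funext k
  rw [hom_eq_chainSum o (mem_letters o)]
  simp

theorem cauchyPartial_eq (n : ℕ) :
    cauchyPartial o n = ((List.range n).map fun j => oneVar j (hom o)).prod := by
  simp only [← prod_cauchyFactor]
  rfl

/-- The last block is the only one containing `x_n`, so it contributes exactly `h_{m n}(u)`, on the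
right. -/
theorem coeff_cauchyPartial (n : ℕ) (m : ℕ →₀ ℕ) :
    MvPowerSeries.coeff m (cauchyPartial o n) =
      if m.support ⊆ Finset.range n then ((List.range n).map fun j => hom o (m j)).prod else 0 := by
  induction n generalizing m with
  | zero =>
    classical
    rw [cauchyPartial_eq, List.range_zero, List.map_nil, List.map_nil, List.prod_nil,
      List.prod_nil, MvPowerSeries.coeff_one, Finset.range_zero]
    simp
  | succ n ih =>
    have hG : ∀ m : ℕ →₀ ℕ, m n ≠ 0 → MvPowerSeries.coeff m (cauchyPartial o n) = 0 := by
      intro m hm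
      rw [ih, if_neg]
      intro h
      exact absurd (h (Finsupp.mem_support_iff.2 hm)) (by simp)
    rw [cauchyPartial_eq, List.range_succ, List.map_append, List.prod_append, ← cauchyPartial_eq,
      List.map_append, List.prod_append, List.map_cons, List.map_nil, List.prod_cons,
      List.prod_nil, mul_one, List.map_cons, List.map_nil, List.prod_cons, List.prod_nil, mul_one,
      coeff_mul_oneVar _ _ hG, ih]
    have h1 : (m.erase n).support ⊆ Finset.range n ↔ m.support ⊆ Finset.range (n + 1) := by
      rw [Finsupp.support_erase, Finset.range_add_one, Finset.subset_insert_iff]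
    have h2 : ((List.range n).map fun j => hom o ((m.erase n) j)) =
        (List.range n).map fun j => hom o (m j) := by
      refine List.map_congr_left fun j hj => ?_
      rw [Finsupp.erase_ne (List.mem_range.1 hj).ne]
    rw [h2]
    simp only [h1, ite_mul, zero_mul]

theorem support_subset_range {m : ℕ →₀ ℕ} {n : ℕ} (h : bound m ≤ n) :
    m.support ⊆ Finset.range n := by
  intro j hj
  have : j ≤ m.support.sup id := Finset.le_sup (f := id) hj
  rw [Finset.mem_range]
  rw [bound] at h
  omega

theorem prod_range_hom {m : ℕ →₀ ℕ} {n : ℕ} (h : m.support ⊆ Finset.range n) :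
    ((List.range n).map fun j => hom o (m j)).prod = homComposition o m := by
  have key : ∀ k l, m.support ⊆ Finset.range k → k ≤ l →
      ((List.range l).map fun j => hom o (m j)).prod =
        ((List.range k).map fun j => hom o (m j)).prod := by
    intro k l hk hkl
    induction l, hkl using Nat.le_induction with
    | base => rfl
    | succ l hl ih =>
      have : m l = 0 := by
        by_contra h0
        have := Finset.mem_range.1 (hk (Finsupp.mem_support_iff.2 h0))
        omega
      rw [List.range_succ, List.map_append, List.prod_append, ih]
      simp [this, hom_zero]
  rw [homComposition]
  rcases le_total n (bound m) with hn | hn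
  · exact (key _ _ h hn).symm
  · exact key _ _ (support_subset_range le_rfl) hn

theorem coeff_cauchy (m : ℕ →₀ ℕ) :
    MvPowerSeries.coeff m (cauchy o) = homComposition o m := by
  change MvPowerSeries.coeff m (cauchyPartial o (bound m)) = _
  rw [coeff_cauchyPartial, if_pos (support_subset_range le_rfl)]
  rfl

theorem eventually_coeff_cauchyPartial (m : ℕ →₀ ℕ) : ∀ᶠ n in Filter.atTop,
    MvPowerSeries.coeff m (cauchyPartial o n) = MvPowerSeries.coeff m (cauchy o) := by
  filter_upwards [Filter.eventually_ge_atTop (bound m)] with n hn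
  rw [coeff_cauchy, coeff_cauchyPartial, if_pos (support_subset_range hn),
    prod_range_hom o (support_subset_range hn)]

theorem hasFormalSum_monomial :
    HasFormalSum (fun α : ℕ →₀ ℕ => MvPowerSeries.monomial α (homComposition o α)) (cauchy o) := by
  classical
  intro m
  constructor
  · refine (Set.finite_singleton m).subset fun α hα => ?_
    rw [Function.mem_support, MvPowerSeries.coeff_monomial] at hα
    by_contra h
    exact hα (if_neg fun e => h e.symm)
  · rw [finsum_eq_single _ m, MvPowerSeries.coeff_monomial_same, coeff_cauchy]
    intro α hα
    exact MvPowerSeries.coeff_monomial_ne hα.symm _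

end Cauchy

/-! ### Words in the Cauchy product -/

section Words

variable {N : ℕ} (o : ShuffleOrder N)

/-- The weakly increasing sequence in `0, …, n - 1` in which `j` occurs `m j` times. -/
def sortedSeq (m : ℕ → ℕ) (n : ℕ) : List ℕ :=
  (List.range n).flatMap fun j => List.replicate (m j) j

theorem sortedSeq_succ (m : ℕ → ℕ) (n : ℕ) :
    sortedSeq m (n + 1) = sortedSeq m n ++ List.replicate (m n) n := by
  simp [sortedSeq, List.range_succ]

theorem lt_of_mem_sortedSeq {m : ℕ → ℕ} {n a : ℕ} (h : a ∈ sortedSeq m n) : a < n := by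
  simp only [sortedSeq, List.mem_flatMap, List.mem_range, List.mem_replicate] at h
  omega

theorem sortedSeq_pairwise (m : ℕ → ℕ) (n : ℕ) : (sortedSeq m n).Pairwise (· ≤ ·) := by
  induction n with
  | zero => simp [sortedSeq]
  | succ n ih =>
    rw [sortedSeq_succ, List.pairwise_append]
    refine ⟨ih, List.pairwise_replicate.2 (Or.inr le_rfl), fun a ha b hb => ?_⟩
    rw [List.eq_of_mem_replicate hb]
    exact (lt_of_mem_sortedSeq ha).le

theorem coe_sortedSeq {m : ℕ →₀ ℕ} {n : ℕ} (h : m.support ⊆ Finset.range n) :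
    (sortedSeq m n : Multiset ℕ) = Finsupp.toMultiset m := by
  have h1 : ∀ n, (sortedSeq m n : Multiset ℕ) = ∑ j ∈ Finset.range n, m j • {j} := by
    intro n
    induction n with
    | zero => simp [sortedSeq]
    | succ n ih =>
      rw [sortedSeq_succ, ← Multiset.coe_add, ih, Finset.sum_range_succ, Multiset.nsmul_singleton,
        Multiset.coe_replicate]
  rw [h1, Finsupp.toMultiset_apply, Finsupp.sum_of_support_subset _ h _ (by simp)]

/-- The relation between consecutive pairs (index of a variable, letter) in the terms of the Cauchy
product. -/
def PairRel (x y : ℕ × Letter N) : Prop :=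
  x.1 < y.1 ∨ (x.1 = y.1 ∧ ChainRel (below o) IsPlain x.2 y.2)

instance : IsTrans (ℕ × Letter N) (PairRel o) := by
  constructor
  rintro x y z (h | ⟨h, h'⟩) (k | ⟨k, k'⟩)
  · exact Or.inl (h.trans k)
  · exact Or.inl (k ▸ h)
  · exact Or.inl (h ▸ k)
  · exact Or.inr ⟨h.trans k, h'.trans k'⟩

/-- There is no condition between the last block and the earlier ones, since the variable index
increases strictly there. -/
theorem pairwise_zip_sortedSeq_succ (m : ℕ → ℕ) (n : ℕ) {w v : List (Letter N)}
    (hw : w.length = (sortedSeq m n).length) (hv : v.length = m n) :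
    ((sortedSeq m (n + 1)).zip (w ++ v)).Pairwise (PairRel o) ↔
      ((sortedSeq m n).zip w).Pairwise (PairRel o) ∧
        v.Pairwise (ChainRel (below o) IsPlain) := by
  have hz : (List.replicate (m n) n).zip v = v.map fun a => (n, a) := by
    exact List.ext_getElem (by simp [hv]) (by simp)
  rw [sortedSeq_succ, List.zip_append hw.symm, hz, List.pairwise_append, List.pairwise_map]
  constructor
  · rintro ⟨h1, h2, -⟩
    exact ⟨h1, h2.imp fun h => (h.resolve_left (lt_irrefl _)).2⟩
  · rintro ⟨h1, h2⟩
    refine ⟨h1, h2.imp fun h => Or.inr ⟨rfl, h⟩, fun x hx y hy => Or.inl ?_⟩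
    obtain ⟨a, -, rfl⟩ := List.mem_map.1 hy
    exact lt_of_mem_sortedSeq (List.of_mem_zip hx).1

theorem wordCoeff_hom (w : List (Letter N)) (k : ℕ) [Decidable
    (w.length = k ∧ w.Pairwise (ChainRel (below o) IsPlain))] : wordCoeff w (hom o k) =
      if w.length = k ∧ w.Pairwise (ChainRel (below o) IsPlain) then 1 else 0 := by
  rw [hom_eq_chainSum o (mem_letters o)]
  refine (wordCoeff_wordSum _ k w).trans ?_
  simp only [mem_letters, implies_true, and_true]

open scoped Classical in
-- The degrees of the factors force the cuts. Labelling each letter with the index of its block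
-- turns "every block is a chain" into one lexicographic condition.
theorem wordCoeff_prod_hom (m : ℕ → ℕ) (n : ℕ) (w : List (Letter N)) :
    wordCoeff w ((List.range n).map fun j => hom o (m j)).prod =
      if w.length = (sortedSeq m n).length ∧ ((sortedSeq m n).zip w).Pairwise (PairRel o)
      then 1 else 0 := by
  induction n generalizing w with
  | zero =>
    rw [List.range_zero, List.map_nil, List.prod_nil, ← word_nil, wordCoeff_word]
    simp [sortedSeq]
  | succ n ih =>
    rw [List.range_succ, List.map_append, List.prod_append, List.map_cons, List.map_nil,
      List.prod_cons, List.prod_nil, mul_one, wordCoeff_mul]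
    have hlen : (sortedSeq m (n + 1)).length = (sortedSeq m n).length + m n := by
      rw [sortedSeq_succ, List.length_append, List.length_replicate]
    by_cases hw : w.length = (sortedSeq m (n + 1)).length
    · rw [Finset.sum_eq_single (sortedSeq m n).length, ih, wordCoeff_hom]
      · have h1 : (w.take (sortedSeq m n).length).length = (sortedSeq m n).length := by
          rw [List.length_take]; omega
        have h2 : (w.drop (sortedSeq m n).length).length = m n := by
          rw [List.length_drop]; omega
        have h3 := pairwise_zip_sortedSeq_succ o m n h1 h2
        rw [List.take_append_drop] at h3
        simp only [h1, h2, h3, hw, true_and]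
        split_ifs <;> simp_all
      · intro i hi hne
        rw [ih, if_neg, zero_mul]
        rintro ⟨h, -⟩
        rw [List.length_take] at h
        rw [Finset.mem_range] at hi
        omega
      · intro h
        rw [Finset.mem_range] at h
        omega
    · rw [if_neg fun h => hw h.1]
      refine Finset.sum_eq_zero fun i hi => ?_
      rw [ih, wordCoeff_hom]
      split_ifs with h1 h2
      · exfalso
        have h1 := h1.1
        have h2 := h2.1
        rw [List.length_take] at h1
        rw [List.length_drop] at h2
        rw [Finset.mem_range] at hi
        omega
      all_goals simp

theorem mem_descents_iff {w : List (Letter N)} {j : ℕ} (hj : j + 1 < w.length) :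
    j ∈ descents o w ↔ ¬ChainRel (below o) IsPlain w[j] w[j + 1] := by
  let _ := o.toLinearOrder
  have h1 : j ∈ descents o w ↔
      (w[j + 1] < w[j] ∨ (w[j] = w[j + 1] ∧ IsBarred w[j])) :=
    ⟨fun ⟨_, h⟩ => h, fun h => ⟨hj, h⟩⟩
  have h2 : ChainRel (below o) IsPlain w[j] w[j + 1] ↔
    (w[j] < w[j + 1] ∨ (w[j] = w[j + 1] ∧ IsPlain w[j])) := Iff.rfl
  rw [h1, h2, ← not_isPlain_iff]
  rcases lt_trichotomy w[j] w[j + 1] with h | h | h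
  · simp [h, h.not_gt, h.ne]
  · simp [h]
  · simp [h, h.not_gt, h.ne']

theorem sum_single_eq_iff {t n : ℕ} {m : ℕ →₀ ℕ} (hn : m.support ⊆ Finset.range n) {i : Fin t → ℕ}
    (hi : Monotone i) : ∑ j, Finsupp.single (i j) 1 = m ↔ List.ofFn i = sortedSeq m n := by
  have h1 : Finsupp.toMultiset (∑ j, Finsupp.single (i j) 1) = (List.ofFn i : Multiset ℕ) := by
    rw [map_sum, ← Fin.univ_val_map, ← Multiset.sum_map_singleton (Multiset.map i _),
      Multiset.map_map]
    simp [Finset.sum]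
  have h2 : (List.ofFn i).Pairwise (· ≤ ·) := List.pairwise_ofFn.2 fun a b hab => hi hab.le
  have hinj := Function.LeftInverse.injective (Finsupp.toMultiset_toFinsupp (α := ℕ))
  rw [← hinj.eq_iff, h1, ← coe_sortedSeq hn, Multiset.coe_eq_coe]
  exact ⟨fun h => h.eq_of_pairwise' h2 (sortedSeq_pairwise m n), fun h => h ▸ List.Perm.refl _⟩

open scoped Classical in
-- Only one weakly increasing index sequence has content `m`, namely `sortedSeq m n`, so the count
-- is `0` or `1`. `PairRel` being transitive, its pairwise form reduces to neighbours, where it is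
-- the descent condition.
theorem coeff_wordQSym {n : ℕ} {m : ℕ →₀ ℕ} (hn : m.support ⊆ Finset.range n)
    (w : List (Letter N)) : MvPowerSeries.coeff m (wordQSym o w) =
      if w.length = (sortedSeq m n).length ∧ ((sortedSeq m n).zip w).Pairwise (PairRel o)
      then 1 else 0 := by
  change (Set.ncard {i : Fin w.length → ℕ | Monotone i ∧
    (∀ (j : ℕ) (hj : j + 1 < w.length), j ∈ descents o w → i ⟨j, by omega⟩ < i ⟨j + 1, hj⟩) ∧
    ∑ j, Finsupp.single (i j) 1 = m} : ℤ) = _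
  have key : ∀ i : Fin w.length → ℕ, Monotone i →
      ((∀ (j : ℕ) (hj : j + 1 < w.length), j ∈ descents o w → i ⟨j, by omega⟩ < i ⟨j + 1, hj⟩) ↔
        ((List.ofFn i).zip w).Pairwise (PairRel o)) := by
    intro i hi
    rw [← List.isChain_iff_pairwise, List.isChain_iff_getElem]
    simp only [List.getElem_zip, List.getElem_ofFn, List.length_zip, List.length_ofFn, min_self,
      PairRel]
    refine forall_congr' fun j => forall_congr' fun hj => ?_
    rw [mem_descents_iff o hj]
    have : i ⟨j, by omega⟩ ≤ i ⟨j + 1, hj⟩ := hi (by simp)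
    constructor
    · intro h
      by_cases hc : ChainRel (below o) IsPlain w[j] w[j + 1]
      · exact this.lt_or_eq.imp_right fun e => ⟨e, hc⟩
      · exact Or.inl (h hc)
    · rintro (h | h) hc
      · exact h
      · exact absurd h.2 hc
  split_ifs with h
  · obtain ⟨hlen, hp⟩ := h
    have hof : List.ofFn (fun j : Fin w.length => (sortedSeq m n)[(j : ℕ)]'(hlen ▸ j.2)) =
        sortedSeq m n := by
      apply List.ext_getElem
      · simp [hlen]
      · simp
    have hmono : Monotone fun j : Fin w.length => (sortedSeq m n)[(j : ℕ)]'(hlen ▸ j.2) := by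
      intro a b hab
      rcases hab.eq_or_lt with rfl | hab
      · exact le_rfl
      · exact List.pairwise_iff_getElem.1 (sortedSeq_pairwise m n) _ _ _ _ hab
    rw [Nat.cast_eq_one, Set.ncard_eq_one]
    refine ⟨_, Set.eq_singleton_iff_unique_mem.2 ⟨⟨hmono, (key _ hmono).2 ?_,
      (sum_single_eq_iff hn hmono).2 hof⟩, ?_⟩⟩
    · rwa [hof]
    · rintro i ⟨hi, -, hi'⟩
      apply List.ofFn_injective
      rw [hof, (sum_single_eq_iff hn hi).1 hi']
  · rw [Nat.cast_eq_zero]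
    convert Set.ncard_empty (Fin w.length → ℕ)
    rw [Set.eq_empty_iff_forall_notMem]
    rintro i ⟨hi, hd, hi'⟩
    have h1 := (key i hi).1 hd
    have h2 := (sum_single_eq_iff hn hi).1 hi'
    rw [h2] at h1
    exact h ⟨by rw [← h2, List.length_ofFn], h1⟩

theorem wordCoeff_homComposition (m : ℕ →₀ ℕ) (w : List (Letter N)) :
    wordCoeff w (homComposition o m) = MvPowerSeries.coeff m (wordQSym o w) := by
  rw [homComposition, wordCoeff_prod_hom, coeff_wordQSym o (support_subset_range le_rfl)]

/-- For a fixed monomial this is the expansion of `h_m(u)` in the basis of words, which is finite.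
-/
theorem hasFormalSum_wordQSym :
    HasFormalSum (fun w : List (Letter N) => seriesMul (wordQSym o w) (word w)) (cauchy o) := by
  classical
  intro m
  have hc : ∀ w : List (Letter N), MvPowerSeries.coeff m (seriesMul (wordQSym o w) (word w)) =
      wordCoeff w (homComposition o m) • word w := by
    intro w
    rw [wordCoeff_homComposition]
    rfl
  simp only [hc, coeff_cauchy]
  generalize homComposition o m = f
  have hfin : (Function.support fun w => wordCoeff w f • (word w : FreeAlg N)).Finite := by
    refine (f.coeff.support.finite_toSet.image FreeMonoid.toList).subset fun w hw => ?_
    refine ⟨FreeMonoid.ofList w, ?_, FreeMonoid.toList_ofList w⟩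
    rw [Finset.mem_coe, Finsupp.mem_support_iff]
    intro h0
    apply hw
    change wordCoeff w f • word w = 0
    rw [wordCoeff_apply, h0, zero_smul]
  refine ⟨hfin, ext_wordCoeff fun v => ?_⟩
  rw [AddMonoidHom.map_finsum _ hfin, finsum_eq_single _ v]
  · rw [map_zsmul, wordCoeff_word, if_pos rfl]
    simp
  · intro w hw
    rw [map_zsmul, wordCoeff_word, if_neg hw.symm, smul_zero]

end Words

/-! ### The pairing -/

section Pairing

variable {N : ℕ} (o : ShuffleOrder N)

theorem pairing_eq_sum_right (f g : FreeAlg N) :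
    pairing f g = g.coeff.sum fun w a => f.coeff w * a := by
  classical
  rw [pairing, Finsupp.sum_of_support_subset f.coeff
      (Finset.subset_union_left (s₂ := g.coeff.support)) _ (by simp),
    Finsupp.sum_of_support_subset g.coeff
      (Finset.subset_union_right (s₁ := f.coeff.support)) _ (by simp)]

/-- The pairing with a fixed element on the right, as an additive map. -/
noncomputable def pairingHom (g : FreeAlg N) : FreeAlg N →+ ℤ where
  toFun f := pairing f g
  map_zero' := by simp [pairing]
  map_add' f f' := by
    simp only [pairing_eq_sum_right, MonoidAlgebra.coeff_add, Finsupp.add_apply, add_mul]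
    exact Finsupp.sum_add

/-- Linear extension of `wordCoeff_homComposition`; every later statement on `F` goes through this
formula. -/
theorem coeff_F (γ : FreeAlg N) (m : ℕ →₀ ℕ) :
    MvPowerSeries.coeff m (F o γ) = pairing (homComposition o m) γ := by
  rw [pairing_eq_sum_right, F, Finsupp.sum, Finsupp.sum, map_sum]
  refine Finset.sum_congr rfl fun w _ => ?_
  have := wordCoeff_homComposition o m w.toList
  rw [wordCoeff_apply, FreeMonoid.ofList_toList] at this
  rw [map_zsmul, this, smul_eq_mul, mul_comm]

end Pairing

/-! ### Dual Jacobi–Trudi determinants -/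

section Determinants

variable {C : Type*} [CommRing C]

theorem det_eq_sum_prod_apply {n : ℕ} (A : Matrix (Fin n) (Fin n) C) :
    A.det = ∑ π : Equiv.Perm (Fin n), ((Equiv.Perm.sign π : ℤ) : C) * ∏ i, A i (π i) := by
  rw [← Matrix.det_transpose, Matrix.det_apply']
  rfl

open scoped Classical in
-- In the Leibniz term of `π`, shifting the rows in `S` is the same as shifting the columns in `π
-- S`, and `π` permutes the `k`-subsets.
theorem sum_powersetCard_det_shift_row {n : ℕ} (k : ℕ) (f : Fin n → ℕ → C) :
    ∑ S ∈ Finset.powersetCard k (Finset.univ : Finset (Fin n)),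
        (Matrix.of fun i j : Fin n => f i (j + if i ∈ S then 1 else 0)).det =
      ∑ S ∈ Finset.powersetCard k (Finset.univ : Finset (Fin n)),
        (Matrix.of fun i j : Fin n => f i (j + if j ∈ S then 1 else 0)).det := by
  simp only [det_eq_sum_prod_apply]
  rw [Finset.sum_comm, Finset.sum_comm (s := Finset.powersetCard k Finset.univ)]
  refine Finset.sum_congr rfl fun π _ => ?_
  refine Finset.sum_equiv π.finsetCongr ?_ ?_
  · intro S
    simp [Finset.mem_powersetCard]
  · intro S _
    simp [Equiv.finsetCongr]

theorem eq_filter_of_upClosed {n k : ℕ} {S : Finset (Fin n)} (hS : S.card = k)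
    (hup : ∀ j ∈ S, ∀ h : (j : ℕ) + 1 < n, (⟨j + 1, h⟩ : Fin n) ∈ S) :
    S = Finset.univ.filter fun j : Fin n => n - k ≤ (j : ℕ) := by
  have hup' : ∀ j ∈ S, Finset.Ici j ⊆ S := by
    intro j hj i hi
    rw [Finset.mem_Ici] at hi
    obtain ⟨d, hd⟩ : ∃ d, (i : ℕ) = j + d := ⟨i - j, by have : (j : ℕ) ≤ i := hi; omega⟩
    induction d generalizing i with
    | zero => rwa [show i = j from Fin.ext hd]
    | succ d ih =>
      have := i.2
      have := hup _ (ih (i := ⟨j + d, by omega⟩) (by rw [Fin.le_def]; simp) rfl)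
        (by simp only; omega)
      rwa [show i = ⟨j + d + 1, by omega⟩ from Fin.ext (by simp only; omega)]
  have hk : k ≤ n := by rw [← hS]; simpa using S.card_le_univ
  refine Finset.eq_of_subset_of_card_le ?_ ?_
  · intro j hj
    have h := Finset.card_le_card (hup' j hj)
    rw [Fin.card_Ici, hS] at h
    simp only [Finset.mem_filter, Finset.mem_univ, true_and]
    have := j.2
    omega
  · rw [hS]
    rcases Nat.eq_zero_or_pos k with rfl | hpos
    · rw [Nat.le_zero, Finset.card_eq_zero, Finset.filter_eq_empty_iff]
      intro j _
      have := j.2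
      omega
    · have : (Finset.univ.filter fun j : Fin n => n - k ≤ (j : ℕ)) =
          Finset.Ici (⟨n - k, by omega⟩ : Fin n) := by
        ext j
        simp [Fin.le_def]
      rw [this, Fin.card_Ici]
      simp only
      omega

open scoped Classical in
-- If `j ∈ S` but `j + 1 ∉ S`, then columns `j` and `j + 1` agree after the shift. Only the final
-- segment of size `k` survives.
theorem sum_powersetCard_det_shift_col {n k : ℕ} (hk : k ≤ n) (f : Fin n → ℕ → C) :
    ∑ S ∈ Finset.powersetCard k (Finset.univ : Finset (Fin n)),
        (Matrix.of fun i j : Fin n => f i (j + if j ∈ S then 1 else 0)).det =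
      (Matrix.of fun i j : Fin n => f i (j + if n - k ≤ (j : ℕ) then 1 else 0)).det := by
  rw [Finset.sum_eq_single (Finset.univ.filter fun j : Fin n => n - k ≤ (j : ℕ))]
  · simp
  · intro S hS hne
    rw [Finset.mem_powersetCard] at hS
    have : ¬∀ j ∈ S, ∀ h : (j : ℕ) + 1 < n, (⟨j + 1, h⟩ : Fin n) ∈ S :=
      fun h => hne (eq_filter_of_upClosed hS.2 h)
    push Not at this
    obtain ⟨j, hj, h, hj'⟩ := this
    refine Matrix.det_zero_of_column_eq (i := j) (j := ⟨j + 1, h⟩) ?_ fun i => ?_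
    · intro h
      have := congrArg Fin.val h
      simp at this
    · simp [hj, hj']
  · intro h
    exfalso
    apply h
    rw [Finset.mem_powersetCard]
    refine ⟨Finset.subset_univ _, ?_⟩
    rcases Nat.eq_zero_or_pos k with rfl | hpos
    · rw [Finset.card_eq_zero, Finset.filter_eq_empty_iff]
      intro j _
      have := j.2
      omega
    · have : (Finset.univ.filter fun j : Fin n => n - k ≤ (j : ℕ)) =
          Finset.Ici (⟨n - k, by omega⟩ : Fin n) := by
        ext j
        simp [Fin.le_def]
      rw [this, Fin.card_Ici]
      simp only
      omega

/-- The extension of a sequence to the integers by zero. -/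
def extendInt (e : ℕ → C) (k : ℤ) : C := if k < 0 then 0 else e k.toNat

theorem extendInt_of_neg (e : ℕ → C) {k : ℤ} (h : k < 0) : extendInt e k = 0 := if_pos h

theorem extendInt_natCast (e : ℕ → C) (k : ℕ) : extendInt e k = e k := by
  rw [extendInt, if_neg (by omega), Int.toNat_natCast]

/-- The determinant of the matrix of the `e (a i + j - i)`. -/
def colDet (e : ℕ → C) (a : ℕ → ℕ) (n : ℕ) : C :=
  (Matrix.of fun i j : Fin n => extendInt e ((a i : ℤ) + (j : ℕ) - (i : ℕ))).det

variable {e h : ℕ → C}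

/-- In the rows from `T` on, `a` vanishes and the first `T` columns have negative indices, so the
matrix is block triangular. The case `δ = 0` enlarges the determinant without changing it; `δ = 1`
multiplies it by `h k`. -/
theorem det_shift_eq_mul {a : ℕ → ℕ} {T : ℕ} (ha : ∀ i, T ≤ i → a i = 0) (k : ℕ) (δ : ℕ) :
    (Matrix.of fun i j : Fin (T + k) =>
      extendInt e ((a i : ℤ) + ((j + if T ≤ (j : ℕ) then δ else 0 : ℕ) : ℤ) - (i : ℕ))).det =
    colDet e a T *
      (Matrix.of fun i j : Fin k => extendInt e ((δ : ℤ) + (j : ℕ) - (i : ℕ))).det := by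
  rw [← Matrix.det_submatrix_equiv_self (finSumFinEquiv (m := T) (n := k)), colDet,
    ← Matrix.det_fromBlocks_zero₂₁ _ (Matrix.of fun (i : Fin T) (j : Fin k) =>
      extendInt e ((a i : ℤ) + ((T + j + δ : ℕ) : ℤ) - (i : ℕ)))]
  congr 1
  ext (i | i) (j | j)
  · simp [not_le.2 j.2]
  · simp
  · simp only [Matrix.submatrix_apply, finSumFinEquiv_apply_right, finSumFinEquiv_apply_left,
      Matrix.of_apply, Fin.val_natAdd, Fin.val_castAdd, Matrix.fromBlocks_apply₂₁,
      Matrix.zero_apply]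
    have := j.2
    rw [ha _ (by omega), if_neg (by omega)]
    exact extendInt_of_neg e (by push_cast; omega)
  · simp only [Matrix.submatrix_apply, finSumFinEquiv_apply_right, Matrix.of_apply,
      Fin.val_natAdd, Matrix.fromBlocks_apply₂₂]
    rw [ha _ (by omega), if_pos (by omega)]
    congr 1
    push_cast
    ring

theorem colDet_add (he : e 0 = 1) {a : ℕ → ℕ} {T : ℕ} (ha : ∀ i, T ≤ i → a i = 0) (k : ℕ) :
    colDet e a (T + k) = colDet e a T := by
  have h1 := det_shift_eq_mul (e := e) ha k 0
  have h2 : (Matrix.of fun i j : Fin k =>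
      extendInt e (((0 : ℕ) : ℤ) + (j : ℕ) - (i : ℕ))).det = 1 := by
    rw [Matrix.det_of_isUpperTriangular]
    · refine Finset.prod_eq_one fun i _ => ?_
      have : ((0 : ℕ) : ℤ) + (i : ℕ) - (i : ℕ) = (0 : ℕ) := by simp
      rw [Matrix.of_apply, this, extendInt_natCast, he]
    · intro i j hij
      have : (j : ℕ) < i := hij
      exact extendInt_of_neg e (by omega)
  rw [h2, mul_one] at h1
  rw [← h1, colDet]
  simp

theorem colDet_eq_of_le (he : e 0 = 1) {a : ℕ → ℕ} {T n : ℕ} (ha : ∀ i, T ≤ i → a i = 0)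
    (hn : T ≤ n) : colDet e a n = colDet e a T := by
  obtain ⟨k, rfl⟩ := Nat.exists_eq_add_of_le hn
  exact colDet_add he ha k

/-- The entries of the unitriangular Toeplitz matrix inverse to that of `e`. -/
def signedToeplitz (h : ℕ → C) (j l : ℕ) : C := if j ≤ l then (-1) ^ (l - j) * h (l - j) else 0

theorem sum_extendInt_mul_signedToeplitz (he : e 0 = 1) (hh : h 0 = 1)
    (hrel : ∀ n ≠ 0, ∑ i ∈ Finset.HasAntidiagonal.antidiagonal n, ((-1) ^ i.1 * e i.1) * h i.2 = 0)
    (i : ℕ) {l p : ℕ} (hl : l ≤ p) :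
    ∑ j ∈ Finset.range (p + 1), extendInt e ((j : ℤ) - i) * signedToeplitz h j l =
      if i = l then 1 else 0 := by
  rcases lt_or_ge l i with hi | hi
  · rw [if_neg hi.ne']
    refine Finset.sum_eq_zero fun j _ => ?_
    by_cases hj : j ≤ l
    · rw [extendInt_of_neg e (by omega), zero_mul]
    · rw [signedToeplitz, if_neg hj, mul_zero]
  obtain ⟨n, rfl⟩ := Nat.exists_eq_add_of_le hi
  have h1 : ∑ j ∈ Finset.range (p + 1), extendInt e ((j : ℤ) - i) * signedToeplitz h j (i + n) =
      ∑ a ∈ Finset.range (n + 1), e a * ((-1) ^ (n - a) * h (n - a)) := by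
    symm
    refine Finset.sum_of_injOn (fun a => i + a) (fun a _ b _ hab => Nat.add_left_cancel hab) ?_ ?_ ?_
    · intro a ha
      simp only [Finset.coe_range, Set.mem_Iio] at ha ⊢
      omega
    · intro j _ hj'
      by_cases hj : j ≤ i + n
      · rcases lt_or_ge j i with hji | hji
        · rw [extendInt_of_neg e (by omega), zero_mul]
        · exact absurd ⟨j - i, by simp only [Finset.coe_range, Set.mem_Iio]; omega,
            by simp only; omega⟩ hj'
      · rw [signedToeplitz, if_neg hj, mul_zero]
    · intro a ha
      rw [Finset.mem_range] at ha
      rw [signedToeplitz, if_pos (by omega), Nat.add_sub_add_left,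
        show ((i + a : ℕ) : ℤ) - i = (a : ℕ) by push_cast; ring, extendInt_natCast]
  rw [h1]
  rcases Nat.eq_zero_or_pos n with rfl | hn
  · simp [he, hh]
  · rw [if_neg (by omega)]
    have h2 := hrel n hn.ne'
    rw [Finset.Nat.sum_antidiagonal_eq_sum_range_succ_mk] at h2
    -- Up to a global sign, the alternation may be placed on `h` or on `e`.
    have h3 : ∑ a ∈ Finset.range (n + 1), e a * ((-1) ^ (n - a) * h (n - a)) =
        (-1) ^ n * ∑ a ∈ Finset.range (n + 1), (-1) ^ a * e a * h (n - a) := by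
      rw [Finset.mul_sum]
      refine Finset.sum_congr rfl fun a ha => ?_
      rw [Finset.mem_range] at ha
      have : (-1 : C) ^ n * (-1) ^ a = (-1) ^ (n - a) := by
        obtain ⟨d, rfl⟩ := Nat.exists_eq_add_of_le (Nat.lt_succ_iff.1 ha)
        rw [Nat.add_sub_cancel_left, pow_add, mul_right_comm, ← mul_pow]
        simp
      rw [← this]
      ring
    rw [h3, h2, mul_zero]

/-- The determinant of the matrix of the `e (1 + j - i)` is `h k`. -/
theorem det_extendInt_one_add (he : e 0 = 1) (hh : h 0 = 1)
    (hrel : ∀ n ≠ 0, ∑ i ∈ Finset.HasAntidiagonal.antidiagonal n, ((-1) ^ i.1 * e i.1) * h i.2 = 0)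
    (k : ℕ) :
    (Matrix.of fun i j : Fin k => extendInt e (((1 : ℕ) : ℤ) + (j : ℕ) - (i : ℕ))).det = h k := by
  cases k with
  | zero => rw [Matrix.det_fin_zero, hh]
  | succ p =>
    -- From its second row on, the given matrix is the unitriangular Toeplitz matrix of `e` moved
    -- down by one row. Multiplying by the inverse `V`, of determinant `1`, turns these rows into
    -- rows of the identity.
    let V : Matrix (Fin (p + 1)) (Fin (p + 1)) C := Matrix.of fun j l => signedToeplitz h j l
    have hV : V.det = 1 := by
      rw [Matrix.det_of_isUpperTriangular]
      · refine Finset.prod_eq_one fun i _ => ?_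
        simp [V, signedToeplitz, hh]
      · intro i j hij
        have : (j : ℕ) < i := hij
        simp only [V, Matrix.of_apply, signedToeplitz]
        rw [if_neg (by omega)]
    rw [← mul_one (Matrix.det _), ← hV, ← Matrix.det_mul]
    generalize hG : (Matrix.of fun i j : Fin (p + 1) =>
      extendInt e (((1 : ℕ) : ℤ) + (j : ℕ) - (i : ℕ))) = G
    have hsucc : ∀ (i : Fin p) (l : Fin (p + 1)),
        (G * V) i.succ l = if (i : ℕ) = l then 1 else 0 := by
      intro i l
      rw [← sum_extendInt_mul_signedToeplitz he hh hrel i (Nat.lt_succ_iff.1 l.2),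
        Finset.sum_range, Matrix.mul_apply]
      refine Finset.sum_congr rfl fun j _ => ?_
      rw [← hG]
      simp only [V, Matrix.of_apply, Fin.val_succ]
      congr 2
      push_cast
      ring
    -- This entry is the inverse relation in degree `p + 1` without its term `e 0 * h (p + 1)`. It
    -- is the only nonzero entry of the last column.
    have hzero : (G * V) 0 (Fin.last p) = (-1) ^ p * h (p + 1) := by
      have h1 := sum_extendInt_mul_signedToeplitz he hh hrel 0 (le_refl (p + 1))
      rw [if_neg (by omega), Finset.sum_range_succ', Finset.sum_range] at h1
      have h2 : (G * V) 0 (Fin.last p) = ∑ j : Fin (p + 1),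
          extendInt e ((((j : ℕ) + 1 : ℕ) : ℤ) - (0 : ℕ)) * signedToeplitz h (j + 1) (p + 1) := by
        rw [Matrix.mul_apply]
        refine Finset.sum_congr rfl fun j _ => ?_
        rw [← hG]
        simp only [V, Matrix.of_apply, signedToeplitz, Fin.val_last, Fin.val_zero,
          Nat.add_le_add_iff_right, Nat.add_sub_add_right]
        congr 2
        push_cast
        ring
      have h3 : extendInt e (((0 : ℕ) : ℤ) - (0 : ℕ)) = 1 := by
        rw [show ((0 : ℕ) : ℤ) - (0 : ℕ) = (0 : ℕ) by simp, extendInt_natCast, he]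
      rw [← h2, h3, one_mul, signedToeplitz, if_pos (by omega), Nat.sub_zero] at h1
      rw [eq_neg_of_add_eq_zero_left h1, pow_succ]
      ring
    rw [Matrix.det_succ_column _ (Fin.last p), Fin.sum_univ_succ, hzero]
    have hrest : ∀ i : Fin p, (G * V) i.succ (Fin.last p) = 0 := by
      intro i
      rw [hsucc, if_neg]
      have := i.2
      simp only [Fin.val_last]
      omega
    have hone : (G * V).submatrix (Fin.succAbove 0) (Fin.last p).succAbove = 1 := by
      ext i l
      rw [Matrix.submatrix_apply, Fin.succAbove_zero, Fin.succAbove_last, hsucc, Matrix.one_apply]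
      simp [Fin.ext_iff]
    simp only [hrest, hone, mul_zero, zero_mul, Finset.sum_const_zero, add_zero, Matrix.det_one,
      mul_one, Fin.val_zero, Fin.val_last, zero_add]
    rw [← mul_assoc, ← mul_pow]
    simp

open scoped Classical in
/-- Multiplication of a dual Jacobi–Trudi determinant by `h k`. -/
theorem mul_colDet (he : e 0 = 1) (hh : h 0 = 1)
    (hrel : ∀ n ≠ 0, ∑ i ∈ Finset.HasAntidiagonal.antidiagonal n, ((-1) ^ i.1 * e i.1) * h i.2 = 0)
    {a : ℕ → ℕ} {T : ℕ} (ha : ∀ i, T ≤ i → a i = 0) (k : ℕ) :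
    h k * colDet e a T =
      ∑ S ∈ Finset.powersetCard k (Finset.univ : Finset (Fin (T + k))),
        (Matrix.of fun i j : Fin (T + k) =>
          extendInt e ((a i : ℤ) + ((j + if i ∈ S then 1 else 0 : ℕ) : ℤ) - (i : ℕ))).det := by
  -- The product becomes one determinant whose last `k` columns are shifted: the surviving column
  -- term, which is traded for the sum over row sets.
  rw [mul_comm, ← det_extendInt_one_add he hh hrel k, ← det_shift_eq_mul ha k 1]
  obtain ⟨f, hf⟩ : ∃ f : Fin (T + k) → ℕ → C,
      ∀ (i : Fin (T + k)) (c : ℕ), extendInt e ((a i : ℤ) + (c : ℤ) - (i : ℕ)) = f i c :=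
    ⟨_, fun _ _ => rfl⟩
  simp only [hf]
  rw [sum_powersetCard_det_shift_row k f,
    sum_powersetCard_det_shift_col (Nat.le_add_left k T) f, Nat.add_sub_cancel]

open scoped Classical in
-- Rows `i` and `i + 1` agree: the extra cell compensates the `- 1` in the index. These are the sets
-- `S` that would make column `i + 1` longer than column `i`.
theorem det_shift_eq_zero {a : ℕ → ℕ} {n : ℕ} {S : Finset (Fin n)} {i i' : Fin n}
    (hii : (i' : ℕ) = i + 1) (ha : a (i + 1) = a i) (hi : i ∉ S) (hi' : i' ∈ S) :
    (Matrix.of fun i j : Fin n =>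
      extendInt e ((a i : ℤ) + ((j + if i ∈ S then 1 else 0 : ℕ) : ℤ) - (i : ℕ))).det = 0 := by
  refine Matrix.det_zero_of_row_eq (i := i) (j := i') (fun h => by rw [h] at hii; omega) ?_
  funext j
  simp only [Matrix.of_apply, if_neg hi, if_pos hi', ha, hii]
  congr 1
  push_cast
  ring

end Determinants

/-! ### Horizontal strips and the Pieri rule -/

section Strips

theorem colLen_eq_zero {ν : YoungDiagram} {j : ℕ} (hj : ν.rowLen 0 ≤ j) : ν.colLen j = 0 := by
  by_contra h
  have : (0, j) ∈ ν := YoungDiagram.mem_iff_lt_colLen.2 (Nat.pos_of_ne_zero h)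
  exact absurd (YoungDiagram.mem_iff_lt_rowLen.1 this) (by omega)

theorem rowLen_zero_le_card (ν : YoungDiagram) : ν.rowLen 0 ≤ ν.card := by
  rw [YoungDiagram.rowLen_eq_card]
  exact Finset.card_le_card (Finset.filter_subset _ _)

theorem card_eq_sum_colLen {ν : YoungDiagram} {n : ℕ} (hn : ν.rowLen 0 ≤ n) :
    ν.card = ∑ j : Fin n, ν.colLen j := by
  rw [← Finset.sum_range (fun j => ν.colLen j)]
  rw [YoungDiagram.card, Finset.card_eq_sum_card_fiberwise (f := Prod.snd) (t := Finset.range n)]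
  · exact Finset.sum_congr rfl fun j _ => (YoungDiagram.colLen_eq_card ν).symm
  · rintro ⟨i, j⟩ hc
    rw [Finset.mem_coe, Finset.mem_range]
    by_contra h
    have h1 := YoungDiagram.mem_iff_lt_colLen.1 ((YoungDiagram.mem_cells _).1 hc)
    rw [colLen_eq_zero (hn.trans (not_lt.1 h))] at h1
    omega

theorem ext_colLen {μ ν : YoungDiagram} (h : ∀ j, μ.colLen j = ν.colLen j) : μ = ν := by
  ext ⟨i, j⟩
  rw [YoungDiagram.mem_cells, YoungDiagram.mem_cells, YoungDiagram.mem_iff_lt_colLen,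
    YoungDiagram.mem_iff_lt_colLen, h]

/-- The Young diagram with given column lengths. -/
def ofColLen (f : ℕ → ℕ) (hf : Antitone f) (n : ℕ) : YoungDiagram where
  cells := (Finset.range (f 0) ×ˢ Finset.range n).filter fun c => c.1 < f c.2
  isLowerSet := by
    rintro ⟨i, j⟩ ⟨i', j'⟩ ⟨hi, hj⟩ h
    simp only [Finset.coe_filter, Finset.mem_product, Finset.mem_range, Set.mem_ofPred_eq] at h ⊢
    simp only at hi hj
    have := hf hj
    omega

theorem colLen_ofColLen {f : ℕ → ℕ} (hf : Antitone f) {n : ℕ} (hn : ∀ j, n ≤ j → f j = 0) (j : ℕ) :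
    (ofColLen f hf n).colLen j = f j := by
  have h : ∀ i, i < (ofColLen f hf n).colLen j ↔ i < f j := by
    intro i
    rw [← YoungDiagram.mem_iff_lt_colLen, ← YoungDiagram.mem_cells]
    simp only [ofColLen, Finset.mem_filter, Finset.mem_product, Finset.mem_range]
    refine ⟨fun h => h.2, fun h => ⟨⟨h.trans_le (hf (Nat.zero_le j)), ?_⟩, h⟩⟩
    by_contra hj
    rw [hn j (not_lt.1 hj)] at h
    omega
  exact le_antisymm (le_of_not_gt fun h' => lt_irrefl _ ((h _).1 h'))
    (le_of_not_gt fun h' => lt_irrefl _ ((h _).2 h'))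

/-- `ν / μ` is a horizontal strip. -/
def IsHorizontalStrip (μ ν : YoungDiagram) : Prop :=
  ∀ j, μ.colLen j ≤ ν.colLen j ∧ ν.colLen j ≤ μ.colLen j + 1

theorem IsHorizontalStrip.le {μ ν : YoungDiagram} (h : IsHorizontalStrip μ ν) : μ ≤ ν := by
  rintro ⟨i, j⟩ hc
  exact YoungDiagram.mem_iff_lt_colLen.2 ((YoungDiagram.mem_iff_lt_colLen.1 hc).trans_le (h j).1)

/-- The columns containing a cell of `ν / μ`. -/
def stripColumns (μ ν : YoungDiagram) (n : ℕ) : Finset (Fin n) :=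
  Finset.univ.filter fun j => μ.colLen j < ν.colLen j

open scoped Classical in
theorem IsHorizontalStrip.colLen_eq {μ ν : YoungDiagram} (h : IsHorizontalStrip μ ν) {n : ℕ}
    (j : Fin n) : ν.colLen j = μ.colLen j + if j ∈ stripColumns μ ν n then 1 else 0 := by
  have := h j
  simp only [stripColumns, Finset.mem_filter, Finset.mem_univ, true_and]
  split_ifs <;> omega

theorem IsHorizontalStrip.card_eq {μ ν : YoungDiagram} (h : IsHorizontalStrip μ ν) {n : ℕ}
    (hμ : μ.rowLen 0 ≤ n) (hν : ν.rowLen 0 ≤ n) :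
    ν.card = μ.card + (stripColumns μ ν n).card := by
  classical
  rw [card_eq_sum_colLen hμ, card_eq_sum_colLen hν, Finset.sum_congr rfl fun j _ => h.colLen_eq j,
    Finset.sum_add_distrib]
  simp

theorem stripColumns_injOn (μ : YoungDiagram) (n : ℕ) :
    Set.InjOn (fun ν => stripColumns μ ν n)
      {ν | IsHorizontalStrip μ ν ∧ ν.rowLen 0 ≤ n} := by
  classical
  rintro ν ⟨hν, hn⟩ ν' ⟨hν', hn'⟩ h
  refine ext_colLen fun j => ?_
  by_cases hj : j < n
  · have h1 := hν.colLen_eq (⟨j, hj⟩ : Fin n)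
    have h2 := hν'.colLen_eq (⟨j, hj⟩ : Fin n)
    have h' : stripColumns μ ν n = stripColumns μ ν' n := h
    rw [← h', ← h1] at h2
    exact h2.symm
  · rw [colLen_eq_zero (hn.trans (not_lt.1 hj)), colLen_eq_zero (hn'.trans (not_lt.1 hj))]

theorem finite_strips (μ : YoungDiagram) (k : ℕ) :
    {ν | IsHorizontalStrip μ ν ∧ ν.card = μ.card + k}.Finite := by
  refine Set.Finite.of_injOn (Set.mapsTo_univ _ _) ((stripColumns_injOn μ (μ.card + k)).mono ?_)
    Set.finite_univ
  rintro ν ⟨h, h'⟩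
  exact ⟨h, h' ▸ rowLen_zero_le_card ν⟩

/-- The diagrams `ν` for which `ν / μ` is a horizontal strip of size `k`. -/
noncomputable def strips (μ : YoungDiagram) (k : ℕ) : Finset YoungDiagram :=
  (finite_strips μ k).toFinset

theorem mem_strips {μ ν : YoungDiagram} {k : ℕ} :
    ν ∈ strips μ k ↔ IsHorizontalStrip μ ν ∧ ν.card = μ.card + k := by
  rw [strips, Set.Finite.mem_toFinset, Set.mem_ofPred_eq]

variable {C : Type*} [CommRing C] {e h : ℕ → C}

/-- The dual Jacobi–Trudi determinant of a Young diagram. -/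
def schurDet (e : ℕ → C) (ν : YoungDiagram) : C := colDet e ν.colLen (ν.rowLen 0)

theorem schurDet_eq (he : e 0 = 1) {ν : YoungDiagram} {n : ℕ} (hn : ν.rowLen 0 ≤ n) :
    schurDet e ν = colDet e ν.colLen n :=
  (colDet_eq_of_le he (fun _ => colLen_eq_zero) hn).symm

/-- The Pieri rule. -/
theorem mul_schurDet (he : e 0 = 1) (hh : h 0 = 1)
    (hrel : ∀ n ≠ 0, ∑ i ∈ Finset.HasAntidiagonal.antidiagonal n, ((-1) ^ i.1 * e i.1) * h i.2 = 0)
    (μ : YoungDiagram) (k : ℕ) : h k * schurDet e μ = ∑ ν ∈ strips μ k, schurDet e ν := by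
  classical
  -- The common size `μ.card + k` bounds the number of columns of `μ` and of every `ν` in the sum.
  have hμ : ∀ i, μ.card ≤ i → μ.colLen i = 0 := fun i hi =>
    colLen_eq_zero ((rowLen_zero_le_card μ).trans hi)
  have hμ' : μ.rowLen 0 ≤ μ.card + k := (rowLen_zero_le_card μ).trans (Nat.le_add_right _ _)
  have hrow : ∀ {ν}, ν ∈ strips μ k → ν.rowLen 0 ≤ μ.card + k := fun hν =>
    (mem_strips.1 hν).2 ▸ rowLen_zero_le_card _
  rw [schurDet_eq he (rowLen_zero_le_card μ), mul_colDet he hh hrel hμ]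
  symm
  refine Finset.sum_of_injOn (fun ν => stripColumns μ ν (μ.card + k)) ?_ ?_ ?_ ?_
  · refine (stripColumns_injOn μ _).mono fun ν hν => ?_
    exact ⟨(mem_strips.1 hν).1, hrow hν⟩
  · intro ν hν
    rw [Finset.mem_coe, Finset.mem_powersetCard]
    have h1 := (mem_strips.1 hν).1.card_eq hμ' (hrow hν)
    have h2 := (mem_strips.1 hν).2
    exact ⟨Finset.subset_univ _, by simp only; omega⟩
  · intro S hS hS'
    rw [Finset.mem_powersetCard] at hS
    by_cases hgood : ∀ i i' : Fin (μ.card + k), (i' : ℕ) = i + 1 →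
        μ.colLen (i + 1) = μ.colLen i → i' ∈ S → i ∈ S
    · exfalso
      apply hS'
      -- Adding a cell to each column in `S` gives a diagram: `hgood` is exactly what keeps the
      -- column lengths weakly decreasing.
      let f : ℕ → ℕ := fun j => μ.colLen j + if ∃ h : j < μ.card + k, ⟨j, h⟩ ∈ S then 1 else 0
      have hf : Antitone f := by
        refine antitone_nat_of_succ_le fun j => ?_
        have h1 := YoungDiagram.colLen_anti μ j (j + 1) (by omega)
        simp only [f]
        split_ifs with h2 h3
        · omega
        · obtain ⟨h2, h2'⟩ := h2
          have : μ.colLen (j + 1) ≠ μ.colLen j := fun h4 =>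
            h3 ⟨by omega, hgood ⟨j, by omega⟩ ⟨j + 1, h2⟩ rfl h4 h2'⟩
          omega
        · omega
        · omega
      have hfn : ∀ j, μ.card + k ≤ j → f j = 0 := by
        intro j hj
        simp only [f]
        rw [hμ j (by omega), if_neg]
        rintro ⟨h, -⟩
        omega
      have hcol := colLen_ofColLen hf hfn
      have hstrip : IsHorizontalStrip μ (ofColLen f hf (μ.card + k)) := by
        intro j
        rw [hcol]
        simp only [f]
        split_ifs <;> omega
      have hSe : stripColumns μ (ofColLen f hf (μ.card + k)) (μ.card + k) = S := by
        ext j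
        simp only [stripColumns, Finset.mem_filter, Finset.mem_univ, true_and, hcol, f]
        split_ifs with h
        · exact iff_of_true (by omega) h.2
        · exact iff_of_false (by omega) fun h' => h ⟨j.2, h'⟩
      have hrow' : (ofColLen f hf (μ.card + k)).rowLen 0 ≤ μ.card + k := by
        by_contra hlt
        have := YoungDiagram.mem_iff_lt_rowLen.2 (not_le.1 hlt)
        rw [YoungDiagram.mem_iff_lt_colLen, hcol, hfn _ le_rfl] at this
        omega
      refine ⟨_, ?_, hSe⟩
      rw [Finset.mem_coe, mem_strips]
      refine ⟨hstrip, ?_⟩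
      rw [hstrip.card_eq hμ' hrow', hSe, hS.2]
    · push Not at hgood
      obtain ⟨i, i', h1, h2, h3, h4⟩ := hgood
      exact det_shift_eq_zero h1 h2 h4 h3
  · intro ν hν
    rw [schurDet_eq he (hrow hν), colDet]
    congr 1
    ext i j
    rw [Matrix.of_apply, Matrix.of_apply, (mem_strips.1 hν).1.colLen_eq i]
    congr 1
    push_cast
    ring

end Strips

/-! ### Branching of semistandard tableaux -/

section Tableaux

variable {ν : YoungDiagram}

theorem content_apply (T : SemistandardYoungTableau ν) (a : ℕ) :
    content T a = (ν.cells.filter fun c => T c.1 c.2 = a).card := by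
  rw [content, Finsupp.finsetSum_apply, Finset.card_filter]
  refine Finset.sum_congr rfl fun c _ => ?_
  rw [Finsupp.single_apply]

theorem entry_mem_support {T : SemistandardYoungTableau ν} {c : ℕ × ℕ} (hc : c ∈ ν) :
    T c.1 c.2 ∈ (content T).support := by
  rw [Finsupp.mem_support_iff, content_apply]
  exact (Finset.card_pos.2 ⟨c, by simp [hc]⟩).ne'

/-- The entries in the diagram lie in the support of `m`, so a tableau is determined by a map from a
finite set of cells to a finite set. -/
theorem finite_content (m : ℕ →₀ ℕ) :
    {T : SemistandardYoungTableau ν | content T = m}.Finite := by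
  have hle : ∀ T ∈ {T : SemistandardYoungTableau ν | content T = m}, ∀ c ∈ ν,
      T c.1 c.2 < bound m := by
    rintro T rfl c hc
    exact Finset.mem_range.1 (support_subset_range le_rfl (entry_mem_support hc))
  have : NeZero (bound m) := ⟨Nat.succ_ne_zero _⟩
  refine Set.Finite.of_injOn
    (f := fun T (c : ν.cells) => Fin.ofNat (bound m) (T c.1.1 c.1.2)) (Set.mapsTo_univ _ _) ?_
    Set.finite_univ
  intro T hT T' hT' h
  ext i j
  by_cases hc : (i, j) ∈ ν
  · have := congrArg Fin.val (congrFun h ⟨(i, j), (YoungDiagram.mem_cells _).2 hc⟩)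
    simp only [Fin.ofNat] at this
    rwa [Nat.mod_eq_of_lt (hle T hT _ hc), Nat.mod_eq_of_lt (hle T' hT' _ hc)] at this
  · rw [T.zeros hc, T'.zeros hc]

/-- The number of semistandard tableaux of given shape and content. -/
noncomputable def kostka (ν : YoungDiagram) (m : ℕ →₀ ℕ) : ℕ :=
  Set.ncard {T : SemistandardYoungTableau ν | content T = m}

theorem kostka_zero (ν : YoungDiagram) [Decidable (ν = ⊥)] :
    kostka ν 0 = if ν = ⊥ then 1 else 0 := by
  split_ifs with h
  · subst h
    rw [kostka, Set.ncard_eq_one]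
    refine ⟨default, Set.eq_singleton_iff_unique_mem.2 ⟨?_, fun T _ => ?_⟩⟩
    · simp [content]
    · ext i j
      rw [T.zeros (YoungDiagram.notMem_bot _), SemistandardYoungTableau.zeros _
        (YoungDiagram.notMem_bot _)]
  · rw [kostka, Set.ncard_eq_zero (finite_content 0), Set.eq_empty_iff_forall_notMem]
    intro T hT
    apply h
    refine le_bot_iff.1 fun c hc => ?_
    have := entry_mem_support (T := T) hc
    rw [hT] at this
    simp at this

/-- The cells with entry less than `n`. -/
def cellsBelow (T : SemistandardYoungTableau ν) (n : ℕ) : YoungDiagram where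
  cells := ν.cells.filter fun c => T c.1 c.2 < n
  isLowerSet := by
    rintro ⟨i, j⟩ ⟨i', j'⟩ ⟨hi, hj⟩ h
    simp only [Finset.coe_filter, YoungDiagram.mem_cells, Set.mem_ofPred_eq] at h ⊢
    simp only at hi hj
    refine ⟨ν.up_left_mem hi hj h.1, lt_of_le_of_lt ?_ h.2⟩
    exact (T.row_weak_of_le hj (ν.up_left_mem hi le_rfl h.1)).trans (T.col_weak hi h.1)

theorem mem_cellsBelow {T : SemistandardYoungTableau ν} {n : ℕ} {c : ℕ × ℕ} :
    c ∈ cellsBelow T n ↔ c ∈ ν ∧ T c.1 c.2 < n := by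
  rw [← YoungDiagram.mem_cells, cellsBelow, Finset.mem_filter, YoungDiagram.mem_cells]

/-- The restriction of a tableau to a smaller diagram. -/
def restrict {μ : YoungDiagram} (T : SemistandardYoungTableau ν) (h : μ ≤ ν) :
    SemistandardYoungTableau μ where
  entry i j := if (i, j) ∈ μ then T i j else 0
  row_weak' {i j1 j2} hj hc := by
    rw [if_pos hc, if_pos (μ.up_left_mem le_rfl hj.le hc)]
    exact T.row_weak hj (h hc)
  col_strict' {i1 i2 j} hi hc := by
    rw [if_pos hc, if_pos (μ.up_left_mem hi.le le_rfl hc)]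
    exact T.col_strict hi (h hc)
  zeros' hc := if_neg hc

theorem restrict_apply {μ : YoungDiagram} (T : SemistandardYoungTableau ν) (h : μ ≤ ν) (i j : ℕ) :
    restrict T h i j = if (i, j) ∈ μ then T i j else 0 := rfl

/-- The extension of a tableau by the entry `n` in a horizontal strip. -/
def extend {μ : YoungDiagram} (T : SemistandardYoungTableau μ) (h : IsHorizontalStrip μ ν) (n : ℕ)
    (hT : ∀ c ∈ μ, T c.1 c.2 < n) : SemistandardYoungTableau ν where
  entry i j := if (i, j) ∈ μ then T i j else if (i, j) ∈ ν then n else 0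
  row_weak' {i j1 j2} hj hc := by
    by_cases h2 : (i, j2) ∈ μ
    · rw [if_pos h2, if_pos (μ.up_left_mem le_rfl hj.le h2)]
      exact T.row_weak hj h2
    · rw [if_neg h2, if_pos hc]
      split_ifs with h1
      · exact (hT _ h1).le
      · exact le_rfl
      · exact Nat.zero_le _
  col_strict' {i1 i2 j} hi hc := by
    by_cases h2 : (i2, j) ∈ μ
    · rw [if_pos h2, if_pos (μ.up_left_mem hi.le le_rfl h2)]
      exact T.col_strict hi h2
    · have h1 : (i1, j) ∈ μ := by
        rw [YoungDiagram.mem_iff_lt_colLen] at hc ⊢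
        have := (h j).2
        omega
      rw [if_neg h2, if_pos hc, if_pos h1]
      exact hT _ h1
  zeros' {i j} hc := by
    rw [if_neg fun h' => hc (h.le h'), if_neg hc]

theorem extend_apply {μ : YoungDiagram} (T : SemistandardYoungTableau μ)
    (h : IsHorizontalStrip μ ν) (n : ℕ) (hT : ∀ c ∈ μ, T c.1 c.2 < n) (i j : ℕ) :
    extend T h n hT i j = if (i, j) ∈ μ then T i j else if (i, j) ∈ ν then n else 0 := rfl

theorem card_eq_sum_content (T : SemistandardYoungTableau ν) {n : ℕ}
    (h : (content T).support ⊆ Finset.range n) : ν.card = ∑ a ∈ Finset.range n, content T a := by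
  simp only [content_apply]
  exact Finset.card_eq_sum_card_fiberwise fun c hc =>
    h (entry_mem_support ((YoungDiagram.mem_cells _).1 hc))

/-- Columns increase strictly and entries are at most `n`, so a column contains at most one entry
`n`. -/
theorem isHorizontalStrip_cellsBelow {T : SemistandardYoungTableau ν} {n : ℕ}
    (h : (content T).support ⊆ Finset.range (n + 1)) : IsHorizontalStrip (cellsBelow T n) ν := by
  intro j
  constructor
  · refine le_of_not_gt fun hlt => ?_
    have := (mem_cellsBelow.1 (YoungDiagram.mem_iff_lt_colLen.2 hlt)).1
    rw [YoungDiagram.mem_iff_lt_colLen] at this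
    exact lt_irrefl _ this
  · refine le_of_not_gt fun hlt => ?_
    have h1 : ((cellsBelow T n).colLen j + 1, j) ∈ ν := YoungDiagram.mem_iff_lt_colLen.2 hlt
    have h2 := T.col_strict (Nat.lt_add_one _) h1
    have h3 := Finset.mem_range.1 (h (entry_mem_support h1))
    have h4 : ((cellsBelow T n).colLen j, j) ∈ cellsBelow T n :=
      mem_cellsBelow.2 ⟨ν.up_left_mem (Nat.le_succ _) le_rfl h1, by simp only at h2 h3 ⊢; omega⟩
    rw [YoungDiagram.mem_iff_lt_colLen] at h4
    exact lt_irrefl _ h4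

theorem content_restrict {μ : YoungDiagram} {T : SemistandardYoungTableau ν} {n : ℕ}
    (hT : (content T).support ⊆ Finset.range (n + 1)) (h : μ ≤ ν) (hμ : cellsBelow T n = μ) :
    content (restrict T h) = (content T).erase n := by
  subst hμ
  ext a
  rw [content_apply]
  have hmem : ∀ c, c ∈ (cellsBelow T n).cells.filter (fun c => restrict T h c.1 c.2 = a) ↔
      (c ∈ ν ∧ T c.1 c.2 < n) ∧ T c.1 c.2 = a := by
    intro c
    rw [Finset.mem_filter, YoungDiagram.mem_cells, restrict_apply]
    refine ⟨fun ⟨h1, h2⟩ => ⟨mem_cellsBelow.1 h1, ?_⟩, fun ⟨h1, h2⟩ => ⟨mem_cellsBelow.2 h1, ?_⟩⟩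
    · rwa [if_pos h1] at h2
    · rwa [if_pos (mem_cellsBelow.2 h1)]
  by_cases ha : a = n
  · subst ha
    rw [Finsupp.erase_same, Finset.card_eq_zero, Finset.eq_empty_iff_forall_notMem]
    intro c hc
    have := (hmem c).1 hc
    omega
  · rw [Finsupp.erase_ne ha, content_apply]
    congr 1
    ext c
    rw [hmem, Finset.mem_filter, YoungDiagram.mem_cells]
    refine ⟨fun ⟨h1, h2⟩ => ⟨h1.1, h2⟩, fun ⟨h1, h2⟩ => ⟨⟨h1, ?_⟩, h2⟩⟩
    have := Finset.mem_range.1 (hT (entry_mem_support h1))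
    omega

theorem card_cellsBelow {T : SemistandardYoungTableau ν} {n : ℕ}
    (h : (content T).support ⊆ Finset.range (n + 1)) :
    ν.card = (cellsBelow T n).card + content T n := by
  have hle := (isHorizontalStrip_cellsBelow h).le
  have h1 := content_restrict h hle rfl
  have h2 : (content (restrict T hle)).support ⊆ Finset.range n := by
    rw [h1, Finsupp.support_erase]
    rwa [Finset.range_add_one, Finset.subset_insert_iff] at h
  rw [card_eq_sum_content T h, card_eq_sum_content _ h2, Finset.sum_range_succ, h1]
  congr 1
  refine Finset.sum_congr rfl fun a ha => ?_
  rw [Finsupp.erase_ne (Finset.mem_range.1 ha).ne]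

open scoped Classical in
-- Deleting the entries `n` and filling the strip `ν / μ` with `n` are inverse to each other.
theorem ncard_fiber_cellsBelow {m : ℕ →₀ ℕ} {n : ℕ} (hm : m.support ⊆ Finset.range (n + 1))
    (μ : YoungDiagram) :
    Set.ncard {T : SemistandardYoungTableau ν | content T = m ∧ cellsBelow T n = μ} =
      if ν ∈ strips μ (m n) then kostka μ (m.erase n) else 0 := by
  have hm' : (m.erase n).support ⊆ Finset.range n := by
    rw [Finsupp.support_erase]
    rwa [Finset.range_add_one, Finset.subset_insert_iff] at hm
  split_ifs with hν
  · obtain ⟨hs, hc⟩ := mem_strips.1 hν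
    refine Set.ncard_congr (fun T _ => restrict T hs.le) ?_ ?_ ?_
    · rintro T ⟨rfl, hμ⟩
      exact content_restrict hm hs.le hμ
    · rintro T T' ⟨hT, hμ⟩ ⟨hT', hμ'⟩ h
      ext i j
      by_cases hcν : (i, j) ∈ ν
      · by_cases hcμ : (i, j) ∈ μ
        · have := DFunLike.congr_fun h i
          have := congrFun this j
          rwa [restrict_apply, restrict_apply, if_pos hcμ, if_pos hcμ] at this
        · have key : ∀ T : SemistandardYoungTableau ν, content T = m → cellsBelow T n = μ →
              T i j = n := by
            rintro T rfl rfl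
            have h1 := Finset.mem_range.1 (hm (entry_mem_support hcν))
            have h2 : ¬T i j < n := fun h => hcμ (mem_cellsBelow.2 ⟨hcν, h⟩)
            simp only at h1
            omega
          rw [key T hT hμ, key T' hT' hμ']
      · rw [T.zeros hcν, T'.zeros hcν]
    · intro T' hT'
      have hlt : ∀ c ∈ μ, T' c.1 c.2 < n := by
        intro c hc
        have := entry_mem_support (T := T') hc
        rw [hT'] at this
        exact Finset.mem_range.1 (hm' this)
      have hbelow : cellsBelow (extend T' hs n hlt) n = μ := by
        ext c
        rw [YoungDiagram.mem_cells, YoungDiagram.mem_cells, mem_cellsBelow, extend_apply]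
        refine ⟨fun ⟨h1, h2⟩ => ?_, fun h1 => ⟨hs.le h1, ?_⟩⟩
        · by_contra h3
          rw [if_neg h3, if_pos h1] at h2
          exact lt_irrefl _ h2
        · rw [if_pos h1]
          exact hlt c h1
      have hres : restrict (extend T' hs n hlt) hs.le = T' := by
        ext i j
        rw [restrict_apply, extend_apply]
        by_cases h1 : (i, j) ∈ μ
        · rw [if_pos h1, if_pos h1]
        · rw [if_neg h1, T'.zeros h1]
      have hsupp : (content (extend T' hs n hlt)).support ⊆ Finset.range (n + 1) := by
        intro a ha
        rw [Finsupp.mem_support_iff, content_apply] at ha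
        obtain ⟨c, hc⟩ := Finset.card_pos.1 (Nat.pos_of_ne_zero ha)
        obtain ⟨h1, h2⟩ := Finset.mem_filter.1 hc
        rw [extend_apply] at h2
        rw [Finset.mem_range]
        split_ifs at h2 with h3
        · have := hlt c h3
          omega
        · omega
        · omega
      have hcont := content_restrict hsupp hs.le hbelow
      rw [hres, hT'] at hcont
      -- Restriction controls all exponents except that of `n`, which is recovered from the number
      -- of cells.
      have hcard := card_cellsBelow hsupp
      rw [hbelow, hc] at hcard
      refine ⟨extend T' hs n hlt, ⟨?_, hbelow⟩, hres⟩
      ext a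
      by_cases ha : a = n
      · subst ha
        omega
      · rw [← Finsupp.erase_ne (f := m) ha, hcont, Finsupp.erase_ne ha]
  · convert Set.ncard_empty (SemistandardYoungTableau ν)
    rw [Set.eq_empty_iff_forall_notMem]
    rintro T ⟨rfl, rfl⟩
    exact hν (mem_strips.2 ⟨isHorizontalStrip_cellsBelow hm, card_cellsBelow hm⟩)

open scoped Classical in
/-- The branching rule. -/
theorem kostka_eq_sum {m : ℕ →₀ ℕ} {n : ℕ} (hm : m.support ⊆ Finset.range (n + 1))
    {A : Finset YoungDiagram} (hA : ∀ μ ∉ A, kostka μ (m.erase n) = 0) :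
    kostka ν m = ∑ μ ∈ A, if ν ∈ strips μ (m n) then kostka μ (m.erase n) else 0 := by
  rw [kostka, Set.ncard_eq_toFinset_card _ (finite_content m),
    Finset.card_eq_sum_card_fiberwise (f := fun T => cellsBelow T n) (t := A)]
  · refine Finset.sum_congr rfl fun μ _ => ?_
    rw [← ncard_fiber_cellsBelow hm μ, ← Set.ncard_coe_finset]
    congr 1
    ext T
    simp
  · intro T hT
    simp only [Set.Finite.coe_toFinset, Set.mem_ofPred_eq] at hT
    subst hT
    -- The restricted tableau witnesses that the Kostka number of `cellsBelow T n` is nonzero.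
    by_contra h
    have h0 := hA _ h
    rw [kostka, Set.ncard_eq_zero (finite_content _)] at h0
    have : restrict T (isHorizontalStrip_cellsBelow hm).le ∈
        {T' : SemistandardYoungTableau (cellsBelow T n) | content T' = (content T).erase n} :=
      content_restrict hm _ rfl
    rw [h0] at this
    exact this

variable {C : Type*} [CommRing C] {e h : ℕ → C}

/-- The expansion of a product of complete homogeneous functions in Schur functions. -/
theorem exists_prod_eq_sum_kostka (he : e 0 = 1) (hh : h 0 = 1)
    (hrel : ∀ n ≠ 0, ∑ i ∈ Finset.HasAntidiagonal.antidiagonal n, ((-1) ^ i.1 * e i.1) * h i.2 = 0)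
    (n : ℕ) {m : ℕ →₀ ℕ} (hm : m.support ⊆ Finset.range n) :
    ∃ A : Finset YoungDiagram, (∀ ν ∉ A, kostka ν m = 0) ∧
      ((List.range n).map fun j => h (m j)).prod = ∑ ν ∈ A, kostka ν m • schurDet e ν := by
  classical
  induction n generalizing m with
  | zero =>
    have : m = 0 := by simpa using hm
    subst this
    refine ⟨{⊥}, fun ν hν => ?_, ?_⟩
    · rw [kostka_zero, if_neg (by simpa using hν)]
    · have hbot : (⊥ : YoungDiagram).rowLen 0 = 0 := by
        by_contra h0
        exact YoungDiagram.notMem_bot (0, 0)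
          (YoungDiagram.mem_iff_lt_rowLen.2 (Nat.pos_of_ne_zero h0))
      rw [Finset.sum_singleton, kostka_zero, if_pos rfl, one_smul,
        schurDet_eq he hbot.le, colDet, Matrix.det_fin_zero]
      rfl
  | succ n ih =>
    have hm' : (m.erase n).support ⊆ Finset.range n := by
      rw [Finsupp.support_erase]
      rwa [Finset.range_add_one, Finset.subset_insert_iff] at hm
    obtain ⟨A, hA, hprod⟩ := ih hm'
    refine ⟨A.biUnion fun μ => strips μ (m n), fun ν hν => ?_, ?_⟩
    · rw [kostka_eq_sum hm hA]
      refine Finset.sum_eq_zero fun μ hμ => if_neg fun hs => hν ?_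
      exact Finset.mem_biUnion.2 ⟨μ, hμ, hs⟩
    · have h1 : ((List.range n).map fun j => h (m j)) =
          (List.range n).map fun j => h ((m.erase n) j) := by
        refine List.map_congr_left fun j hj => ?_
        rw [Finsupp.erase_ne (List.mem_range.1 hj).ne]
      rw [List.range_succ, List.map_append, List.prod_append, h1, hprod, List.map_cons,
        List.map_nil, List.prod_cons, List.prod_nil, mul_one, Finset.sum_mul]
      have h2 : ∀ μ ∈ A, kostka μ (m.erase n) • schurDet e μ * h (m n) =
          ∑ ν ∈ A.biUnion fun μ => strips μ (m n),
            (if ν ∈ strips μ (m n) then kostka μ (m.erase n) else 0) • schurDet e ν := by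
        intro μ hμ
        rw [smul_mul_assoc, mul_comm, mul_schurDet he hh hrel, Finset.smul_sum]
        rw [← Finset.sum_subset (Finset.subset_biUnion_of_mem (fun μ => strips μ (m n)) hμ)]
        · exact Finset.sum_congr rfl fun ν hν => by rw [if_pos hν]
        · intro ν _ hν
          rw [if_neg hν, zero_smul]
      rw [Finset.sum_congr rfl h2, Finset.sum_comm]
      refine Finset.sum_congr rfl fun ν _ => ?_
      rw [← Finset.sum_smul, ← kostka_eq_sum hm hA]

end Tableaux

/-! ### Expansions in the quotient -/

section Quotient

variable {N : ℕ} (o : ShuffleOrder N) (I : Ideal (FreeAlg N)) [I.IsTwoSided]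

/-- If the `e_k(u)` commute in `𝒰/I`, then they and the `h_k(u)` lie in the image of a commutative
ring. -/
theorem exists_commRing_lift (hI : ElemCommute o I) :
    ∃ (C : Type) (_ : CommRing C) (φ : C →+* FreeAlg N ⧸ I) (e h : ℕ → C),
      (∀ k, φ (e k) = Ideal.Quotient.mk I (elem o k)) ∧
      (∀ k, φ (h k) = Ideal.Quotient.mk I (hom o k)) ∧ e 0 = 1 ∧ h 0 = 1 ∧
      ∀ n ≠ 0, ∑ i ∈ Finset.HasAntidiagonal.antidiagonal n, ((-1) ^ i.1 * e i.1) * h i.2 = 0 := by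
  let s : Set (FreeAlg N ⧸ I) := Set.range fun k => Ideal.Quotient.mk I (elem o k)
  have hs : ∀ x ∈ s, ∀ y ∈ s, x * y = y * x := by
    rintro _ ⟨k, rfl⟩ _ ⟨l, rfl⟩
    exact hI k l
  have := Subring.isMulCommutative_closure hs
  let _ : CommRing (Subring.closure s) :=
    { (inferInstance : Ring (Subring.closure s)) with mul_comm := fun a b => mul_comm' a b }
  have he : ∀ k, Ideal.Quotient.mk I (elem o k) ∈ Subring.closure s := fun k =>
    Subring.subset_closure ⟨k, rfl⟩
  -- The `h_k` are integer polynomials in the `e_k`, by the recursion from `E(-x) H(x) = 1`.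
  have hh : ∀ k, Ideal.Quotient.mk I (hom o k) ∈ Subring.closure s := by
    intro k
    induction k using Nat.strong_induction_on with
    | _ n ih =>
      cases n with
      | zero => rw [hom_zero, map_one]; exact one_mem _
      | succ n =>
        have := sum_antidiagonal_mk_elem_mul_mk_hom o I (n := n + 1) (by omega)
        rw [Finset.Nat.antidiagonal_succ, Finset.sum_cons, elem_zero, map_one, pow_zero, one_smul,
          one_mul] at this
        rw [eq_neg_of_add_eq_zero_left this]
        refine neg_mem (sum_mem fun i hi => mul_mem (zsmul_mem (he _) _) (ih _ ?_))
        simp only [Finset.mem_map, Finset.HasAntidiagonal.mem_antidiagonal] at hi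
        obtain ⟨j, hj, rfl⟩ := hi
        simp
        omega
  refine ⟨Subring.closure s, inferInstance, (Subring.closure s).subtype, fun k => ⟨_, he k⟩,
    fun k => ⟨_, hh k⟩, fun _ => rfl, fun _ => rfl, ?_, ?_, ?_⟩
  · apply Subtype.ext
    change Ideal.Quotient.mk I (elem o 0) = 1
    rw [elem_zero, map_one]
  · apply Subtype.ext
    change Ideal.Quotient.mk I (hom o 0) = 1
    rw [hom_zero, map_one]
  · intro n hn
    apply (Subring.closure s).subtype_injective
    have := sum_antidiagonal_mk_elem_mul_mk_hom o I hn
    rw [map_sum]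
    refine (Finset.sum_congr rfl fun i _ => ?_).trans this
    rw [zsmul_eq_mul, Int.cast_pow, Int.cast_neg, Int.cast_one]
    rfl

variable {o I}

theorem map_schurDet {C : Type} [CommRing C] {φ : C →+* FreeAlg N ⧸ I} {e : ℕ → C}
    (he : ∀ k, φ (e k) = Ideal.Quotient.mk I (elem o k)) (ν : YoungDiagram) :
    φ (schurDet e ν) = Ideal.Quotient.mk I (superSchur o ν) := by
  have hint : ∀ k : ℤ, φ (extendInt e k) = Ideal.Quotient.mk I (elemInt o k) := by
    intro k
    rw [extendInt, elemInt]
    split_ifs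
    · rw [map_zero, map_zero]
    · exact he _
  rw [schurDet, colDet, det_eq_sum_prod_apply, superSchur, map_sum, map_sum]
  refine Finset.sum_congr rfl fun π _ => ?_
  rw [map_mul, map_intCast, map_zsmul, zsmul_eq_mul, ← List.prod_ofFn, map_list_prod,
    map_list_prod, List.map_ofFn, List.map_ofFn]
  congr 3
  funext i
  exact hint _

theorem map_finsuppProd {C : Type} [CommRing C] {φ : C →+* FreeAlg N ⧸ I} {h : ℕ → C}
    (hh : ∀ k, φ (h k) = Ideal.Quotient.mk I (hom o k)) (h0 : h 0 = 1) (m : ℕ →₀ ℕ) :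
    φ (m.prod fun _ k => h k) = Ideal.Quotient.mk I (homComposition o m) := by
  have : (m.prod fun _ k => h k) = ((List.range (bound m)).map fun j => h (m j)).prod := by
    rw [Finsupp.prod_of_support_subset _ (support_subset_range (le_refl (bound m))) _
      fun _ _ => h0]
    rfl
  rw [this, homComposition, map_list_prod, map_list_prod, List.map_map, List.map_map]
  congr 2
  funext j
  exact hh _

/-- In the commutative ring, `h_m` is an unordered product over the support of `m`. This is the
source of the symmetry of `F`. -/
theorem mk_homComposition_embDomain (hI : ElemCommute o I) (σ : ℕ ↪ ℕ) (m : ℕ →₀ ℕ) :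
    Ideal.Quotient.mk I (homComposition o (m.embDomain σ)) =
      Ideal.Quotient.mk I (homComposition o m) := by
  obtain ⟨C, _, φ, e, h, -, hh, -, h0, -⟩ := exists_commRing_lift o I hI
  rw [← map_finsuppProd hh h0, ← map_finsuppProd hh h0, Finsupp.prod_embDomain]

theorem mk_homPartition (hI : ElemCommute o I) {ν : YoungDiagram} {m : ℕ →₀ ℕ}
    (hν : m.support.val.map m = (ν.rowLens : Multiset ℕ)) :
    Ideal.Quotient.mk I (homPartition o ν) = Ideal.Quotient.mk I (homComposition o m) := by
  obtain ⟨C, _, φ, e, h, -, hh, -, h0, -⟩ := exists_commRing_lift o I hI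
  have : (m.prod fun _ k => h k) = (ν.rowLens.map h).prod := by
    rw [← Multiset.prod_coe, ← Multiset.map_coe, ← hν, Multiset.map_map]
    rfl
  rw [← map_finsuppProd hh h0, this, homPartition, map_list_prod, map_list_prod, List.map_map,
    List.map_map]
  congr 2
  funext j
  exact (hh _).symm

theorem exists_mk_homComposition_eq_sum (hI : ElemCommute o I) (m : ℕ →₀ ℕ) :
    ∃ A : Finset YoungDiagram, (∀ ν ∉ A, kostka ν m = 0) ∧
      Ideal.Quotient.mk I (homComposition o m) =
        ∑ ν ∈ A, kostka ν m • Ideal.Quotient.mk I (superSchur o ν) := by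
  obtain ⟨C, _, φ, e, h, he, hh, he0, hh0, hrel⟩ := exists_commRing_lift o I hI
  obtain ⟨A, hA, hprod⟩ := exists_prod_eq_sum_kostka he0 hh0 hrel (bound m)
    (support_subset_range (le_refl (bound m)))
  refine ⟨A, hA, ?_⟩
  have := congrArg φ hprod
  rw [map_list_prod, List.map_map, map_sum] at this
  rw [homComposition, map_list_prod, List.map_map]
  refine Eq.trans ?_ (this.trans (Finset.sum_congr rfl fun ν _ => ?_))
  · congr 2
    funext j
    exact (hh _).symm
  · rw [map_nsmul, map_schurDet he]

theorem coeff_schur (ν : YoungDiagram) (m : ℕ →₀ ℕ) :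
    MvPowerSeries.coeff m (schur ν) = (kostka ν m : ℤ) := rfl

theorem exists_rowLens_eq (s : Multiset ℕ) (hs : 0 ∉ s) :
    ∃ ν : YoungDiagram, s = (ν.rowLens : Multiset ℕ) := by
  have hpos : ∀ x ∈ s.sort (· ≥ ·), 0 < x := by
    intro x hx
    rw [Multiset.mem_sort] at hx
    exact Nat.pos_of_ne_zero fun h => hs (h ▸ hx)
  have hsort : (s.sort (· ≥ ·)).SortedGE := (Multiset.pairwise_sort s (· ≥ ·)).sortedGE
  refine ⟨YoungDiagram.ofRowLens _ hsort, ?_⟩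
  rw [YoungDiagram.rowLens_ofRowLens_eq_self hpos, Multiset.sort_eq]

theorem rowLens_injective {μ ν : YoungDiagram}
    (h : (μ.rowLens : Multiset ℕ) = (ν.rowLens : Multiset ℕ)) : μ = ν := by
  apply YoungDiagram.equivListRowLens.injective
  apply Subtype.ext
  exact (Multiset.coe_eq_coe.1 h).eq_of_pairwise' μ.rowLens_sorted.pairwise
    ν.rowLens_sorted.pairwise

/-- Each monomial `x^m` occurs in exactly one `m_ν`, where `ν` collects the nonzero exponents of
`m`. -/
theorem hasFormalSum_monomialSym (hI : ElemCommute o I) :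
    HasFormalSum (fun ν : YoungDiagram => seriesMul (monomialSym ν)
      (Ideal.Quotient.mk I (homPartition o ν)))
      (MvPowerSeries.map (Ideal.Quotient.mk I) (cauchy o)) := by
  classical
  intro m
  obtain ⟨ν₀, hν₀⟩ := exists_rowLens_eq (m.support.val.map m) (by
    intro h
    obtain ⟨j, hj, hj'⟩ := Multiset.mem_map.1 h
    exact Finsupp.mem_support_iff.1 hj hj')
  have hc : ∀ ν, MvPowerSeries.coeff m (seriesMul (monomialSym ν)
      (Ideal.Quotient.mk I (homPartition o ν))) =
      if ν = ν₀ then Ideal.Quotient.mk I (homComposition o m) else 0 := by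
    intro ν
    change MvPowerSeries.coeff m (monomialSym ν) • Ideal.Quotient.mk I (homPartition o ν) = _
    by_cases h : ν = ν₀
    · subst h
      have : MvPowerSeries.coeff m (monomialSym ν) = 1 := if_pos hν₀
      rw [this, if_pos rfl, one_smul, mk_homPartition hI hν₀]
    · have : MvPowerSeries.coeff m (monomialSym ν) = 0 :=
        if_neg fun h' => h (rowLens_injective (h'.symm.trans hν₀))
      rw [this, if_neg h, zero_smul]
  simp only [hc]
  constructor
  · refine (Set.finite_singleton ν₀).subset fun ν hν => ?_
    by_contra h
    exact hν (if_neg h)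
  · rw [finsum_eq_single _ ν₀ fun ν hν => if_neg hν, if_pos rfl, MvPowerSeries.coeff_map,
      coeff_cauchy]

theorem hasFormalSum_schur (hI : ElemCommute o I) :
    HasFormalSum (fun ν : YoungDiagram => seriesMul (schur ν)
      (Ideal.Quotient.mk I (superSchur o ν)))
      (MvPowerSeries.map (Ideal.Quotient.mk I) (cauchy o)) := by
  intro m
  obtain ⟨A, hA, hsum⟩ := exists_mk_homComposition_eq_sum hI m
  have hc : ∀ ν, MvPowerSeries.coeff m (seriesMul (schur ν)
      (Ideal.Quotient.mk I (superSchur o ν))) =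
      kostka ν m • Ideal.Quotient.mk I (superSchur o ν) := fun ν => natCast_zsmul _ _
  simp only [hc]
  have hsupp : (Function.support fun ν => kostka ν m • Ideal.Quotient.mk I (superSchur o ν)) ⊆
      (A : Set YoungDiagram) := by
    intro ν hν
    by_contra h
    apply hν
    change kostka ν m • _ = _
    rw [hA ν h, zero_smul]
  refine ⟨A.finite_toSet.subset hsupp, ?_⟩
  rw [finsum_eq_sum_of_support_subset _ hsupp, MvPowerSeries.coeff_map, coeff_cauchy, hsum]

/-- For `γ ∈ I^⊥` the functional `⟨·, γ⟩` descends to `𝒰/I`, so identities in the quotient can be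
paired with `γ`. -/
theorem pairing_eq_of_mk_eq {γ : FreeAlg N} (hγ : γ ∈ perp I) {f g : FreeAlg N}
    (h : Ideal.Quotient.mk I f = Ideal.Quotient.mk I g) : pairing f γ = pairing g γ := by
  have h1 := hγ _ (Ideal.Quotient.eq.1 h)
  change pairingHom γ (f - g) = 0 at h1
  rw [map_sub, sub_eq_zero] at h1
  exact h1

theorem isSymmetricSeries_F (hI : ElemCommute o I) {γ : FreeAlg N} (hγ : γ ∈ perp I) :
    IsSymmetricSeries (F o γ) := by
  intro σ
  ext m
  -- The coefficient of a renamed series is known at exponents of the form `embDomain`; as `σ` is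
  -- bijective, every exponent is of this form.
  obtain ⟨m', rfl⟩ : ∃ m' : ℕ →₀ ℕ, m = m'.embDomain σ.toEmbedding := by
    refine ⟨m.embDomain σ.symm.toEmbedding, ?_⟩
    ext i
    obtain ⟨j, rfl⟩ := σ.surjective i
    obtain ⟨k, rfl⟩ := σ.symm.surjective j
    have h1 := Finsupp.embDomain_apply_self σ.toEmbedding (m.embDomain σ.symm.toEmbedding)
      (σ.symm k)
    have h2 := Finsupp.embDomain_apply_self σ.symm.toEmbedding m k
    simp only [Equiv.coe_toEmbedding] at h1 h2
    rw [h1, h2, Equiv.apply_symm_apply]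
  have : MvPowerSeries.coeff (m'.embDomain σ.toEmbedding) (MvPowerSeries.renameEquiv ℤ σ (F o γ)) =
      MvPowerSeries.coeff m' (F o γ) := MvPowerSeries.coeff_embDomain_rename σ.toEmbedding _ _
  rw [this, coeff_F, coeff_F]
  exact pairing_eq_of_mk_eq hγ (mk_homComposition_embDomain hI _ _).symm

theorem hasFormalSum_F (hI : ElemCommute o I) {γ : FreeAlg N} (hγ : γ ∈ perp I) :
    HasFormalSum (fun ν : YoungDiagram => pairing (superSchur o ν) γ • schur ν) (F o γ) := by
  intro m
  obtain ⟨A, hA, hsum⟩ := exists_mk_homComposition_eq_sum hI m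
  have hc : ∀ ν, MvPowerSeries.coeff m (pairing (superSchur o ν) γ • schur ν) =
      kostka ν m • pairing (superSchur o ν) γ := by
    intro ν
    rw [map_zsmul, coeff_schur, smul_eq_mul, nsmul_eq_mul, mul_comm]
  simp only [hc]
  have hsupp : (Function.support fun ν => kostka ν m • pairing (superSchur o ν) γ) ⊆
      (A : Set YoungDiagram) := by
    intro ν hν
    by_contra h
    apply hν
    change kostka ν m • _ = _
    rw [hA ν h, zero_smul]
  refine ⟨A.finite_toSet.subset hsupp, ?_⟩
  have h1 : Ideal.Quotient.mk I (homComposition o m) =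
      Ideal.Quotient.mk I (∑ ν ∈ A, kostka ν m • superSchur o ν) := by
    rw [hsum, map_sum]
    exact Finset.sum_congr rfl fun ν _ => (map_nsmul _ _ _).symm
  rw [finsum_eq_sum_of_support_subset _ hsupp, coeff_F, pairing_eq_of_mk_eq hγ h1]
  change _ = pairingHom γ _
  rw [map_sum]
  exact Finset.sum_congr rfl fun ν _ => (map_nsmul (pairingHom γ) _ _).symm

end Quotient

end SuperSchur

theorem theorem2p3 (N : ℕ) :
    -- the case of `I_kron` and the natural order
    SuperSchur.ElemCommute (SuperSchur.naturalOrder N) (SuperSchur.kronIdeal N) ∧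
    (∀ γ ∈ SuperSchur.perp (SuperSchur.kronIdeal N),
      SuperSchur.IsSymmetricSeries (SuperSchur.F (SuperSchur.naturalOrder N) γ) ∧
      SuperSchur.HasFormalSum
        (fun ν : YoungDiagram =>
          SuperSchur.pairing (SuperSchur.superSchur (SuperSchur.naturalOrder N) ν) γ •
            SuperSchur.schur ν)
        (SuperSchur.F (SuperSchur.naturalOrder N) γ)) ∧
    -- the general case
    (∀ o : SuperSchur.ShuffleOrder N,
      -- the infinite Cauchy product converges
      (∀ m : ℕ →₀ ℕ, ∀ᶠ n in Filter.atTop,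
        MvPowerSeries.coeff m (SuperSchur.cauchyPartial o n) =
          MvPowerSeries.coeff m (SuperSchur.cauchy o)) ∧
      -- its two expansions in `𝒰`
      SuperSchur.HasFormalSum
        (fun w : List (SuperSchur.Letter N) =>
          SuperSchur.seriesMul (SuperSchur.wordQSym o w) (SuperSchur.word w))
        (SuperSchur.cauchy o) ∧
      SuperSchur.HasFormalSum
        (fun α : ℕ →₀ ℕ => MvPowerSeries.monomial α (SuperSchur.homComposition o α))
        (SuperSchur.cauchy o) ∧
      (∀ (γ : SuperSchur.FreeAlg N) (m : ℕ →₀ ℕ),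
        MvPowerSeries.coeff m (SuperSchur.F o γ) =
          SuperSchur.pairing (MvPowerSeries.coeff m (SuperSchur.cauchy o)) γ) ∧
      (∀ (I : Ideal (SuperSchur.FreeAlg N)) [I.IsTwoSided],
        (SuperSchur.ElemCommute o I ↔ SuperSchur.HomCommute o I) ∧
        (SuperSchur.ElemCommute o I →
          -- the expansions of the Cauchy product in `𝒰/I`
          SuperSchur.HasFormalSum
            (fun ν : YoungDiagram => SuperSchur.seriesMul (SuperSchur.monomialSym ν)
              (Ideal.Quotient.mk I (SuperSchur.homPartition o ν)))
            (MvPowerSeries.map (Ideal.Quotient.mk I) (SuperSchur.cauchy o)) ∧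
          SuperSchur.HasFormalSum
            (fun ν : YoungDiagram => SuperSchur.seriesMul (SuperSchur.schur ν)
              (Ideal.Quotient.mk I (SuperSchur.superSchur o ν)))
            (MvPowerSeries.map (Ideal.Quotient.mk I) (SuperSchur.cauchy o)) ∧
          (∀ γ ∈ SuperSchur.perp I,
            SuperSchur.IsSymmetricSeries (SuperSchur.F o γ) ∧
            SuperSchur.HasFormalSum
              (fun ν : YoungDiagram =>
                SuperSchur.pairing (SuperSchur.superSchur o ν) γ • SuperSchur.schur ν)
              (SuperSchur.F o γ))))) := by
  -- Apart from this commutation, the statement on `I_kron` is the general case for the natural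
  -- order.
  have hK := SuperSchur.elemCommute_kronIdeal N
  refine ⟨hK, fun γ hγ => ⟨SuperSchur.isSymmetricSeries_F hK hγ, SuperSchur.hasFormalSum_F hK hγ⟩,
    fun o => ⟨SuperSchur.eventually_coeff_cauchyPartial o, SuperSchur.hasFormalSum_wordQSym o,
      SuperSchur.hasFormalSum_monomial o, fun γ m => ?_, fun I _ =>
      ⟨SuperSchur.elemCommute_iff_homCommute o I, fun hI =>
        ⟨SuperSchur.hasFormalSum_monomialSym hI, SuperSchur.hasFormalSum_schur hI, fun γ hγ =>
          ⟨SuperSchur.isSymmetricSeries_F hI hγ, SuperSchur.hasFormalSum_F hI hγ⟩⟩⟩⟩⟩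
  rw [SuperSchur.coeff_F, SuperSchur.coeff_cauchy]
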